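/- For an $N\times N$ unitary matrix $U$ with eigenvalues (counted with multiplicity) $e^{i\theta_1},\dots,e^{i\theta_N}$, $\theta_n\in(-\pi,\pi]$, let \[ Z(\theta)=Z_U(\theta)=\det\left(I-e^{-i\theta}U\right)=\prod_{m=1}^N\left(1-e^{i\theta_m}e^{-i\theta}\right)\qquad(\theta\in\mathbb{C}). \] Let $\mathbb{E}_N$ denote expectation with respect to the Haar probability measure on the group $U(N)$ of $N\times N$ unitary matrices. For $\alpha_1,\dots,\alpha_k\in\mathbb{C}$ the random variable $\theta_N$ in $\mathbb{E}_N\left[\prod_{r=1}^k Z(\theta_N+\alpha_r)\right]$ is an eigenangle of $U$, no eigenangle being preferred, that is, \[ \mathbb{E}_N\Big[\prod_{r=1}^k Z(\theta_N+\alpha_r)\Big]=\mathbb{E}_N\Big[\frac1N\sum_{n=1}^N\prod_{r=1}^k Z(\theta_n+\alpha_r)\Big]. \] Let $h_m(a_1,\dots,a_k)=\sum_{n_1,\dots,n_k\ge 0,\ n_1+\dots+n_k=m}a_1^{n_1}\cdots a_k^{n_k}$ be the complete homogeneous symmetric polynomial of degree $m$. Theorem. Let $k\ge 0$ be an integer.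 The random variables above are integrable, and for all $a_1,\dots,a_k\in\mathbb{C}$ the series below converges absolutely and \[ \lim_{N\to\infty}\mathbb{E}_N\Big[\prod_{r=1}^k Z\Big(\theta_N+\frac{a_r}{N}\Big)\Big]=\sum_{m=0}^\infty\frac{(-1)^m\, i^{k+m}}{(m+k+1)!}\,h_m(a_1,\dots,a_k)\prod_{j=1}^k a_j , \] uniformly for $a_1,\dots,a_k$ in bounded sets: for every $R$ the convergence is uniform on $\{(a_1,\dots,a_k)\in\mathbb{C}^k : |a_r|\le R \text{ for all } r\}$. -/

import Mathlib

open MeasureTheory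

/-- The group `U(N)` of `N × N` complex unitary matrices. -/
abbrev UnitaryN (N : ℕ) : Type := Matrix.unitaryGroup (Fin N) ℂ

/-- `U(N)` carries its Borel σ-algebra. -/
noncomputable instance instMeasurableSpaceUnitaryN (N : ℕ) : MeasurableSpace (UnitaryN N) :=
  borel (UnitaryN N)

instance instBorelSpaceUnitaryN (N : ℕ) : BorelSpace (UnitaryN N) := ⟨rfl⟩

/-- `U(N)` is compact. -/
instance instCompactSpaceUnitaryN (N : ℕ) : CompactSpace (UnitaryN N) := by
  have hK : IsCompact
      (Set.univ.pi (fun _ : Fin N => Set.univ.pi (fun _ : Fin N => Metric.closedBall (0 : ℂ) 1))) :=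
    isCompact_univ_pi fun _ => isCompact_univ_pi fun _ => isCompact_closedBall 0 1
  have hc : IsClosed ((Matrix.unitaryGroup (Fin N) ℂ : Set (Matrix (Fin N) (Fin N) ℂ))) :=
    isClosed_unitary
  refine isCompact_iff_compactSpace.mp (IsCompact.of_isClosed_subset hK hc ?_)
  intro U hU i _ j _
  simpa using entry_norm_bound_of_unitary hU i j

/-- The Haar measure on `U(N)`, normalised to be a probability measure. -/
noncomputable def haarUnitary (N : ℕ) : Measure (UnitaryN N) :=
  Measure.haarMeasure ⊤

instance instIsProbabilityMeasureHaarUnitary (N : ℕ) : IsProbabilityMeasure (haarUnitary N) :=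
  ⟨by simpa [haarUnitary] using
    Measure.haarMeasure_self (K₀ := (⊤ : TopologicalSpace.PositiveCompacts (UnitaryN N)))⟩

/-- The characteristic polynomial `Z(θ) = det (I - e^{-iθ} U)` of a unitary matrix, as a function of
a complex angle; it vanishes exactly where `e^{iθ}` is an eigenvalue of `U`. -/
noncomputable def charPolyZ {N : ℕ} (U : UnitaryN N) (θ : ℂ) : ℂ :=
  (1 - Complex.exp (-Complex.I * θ) • (U : Matrix (Fin N) (Fin N) ℂ)).det

/-- The eigenangles `θ₁, …, θ_N ∈ (-π, π]` of a unitary matrix: its eigenvalues, with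
multiplicity, are `e^{iθ₁}, …, e^{iθ_N}`. -/
noncomputable def eigenangles {N : ℕ} (U : UnitaryN N) : Multiset ℝ :=
  (U : Matrix (Fin N) (Fin N) ℂ).charpoly.roots.map Complex.arg

/-- For a fixed `U`, the mean of `∏ᵣ Z(θ + αᵣ)` over an eigenangle `θ` of `U`, all `N` eigenangles
(with multiplicity) being equally likely. -/
noncomputable def shiftedProductMean {N k : ℕ} (α : Fin k → ℂ) (U : UnitaryN N) : ℂ :=
  (1 / (N : ℂ)) * ((eigenangles U).map fun θ : ℝ => ∏ r, charPolyZ U ((θ : ℂ) + α r)).sum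

/-- `𝔼_N[∏ᵣ Z(θ_N + αᵣ)]`: the expectation over Haar measure on `U(N)`, where `θ_N` is an eigenangle
of the random matrix, no eigenangle being preferred. -/
noncomputable def shiftedMoment (N : ℕ) {k : ℕ} (α : Fin k → ℂ) : ℂ :=
  ∫ U, shiftedProductMean α U ∂(haarUnitary N)

/-- The complete homogeneous symmetric polynomial `h_m` evaluated at `a₁, …, a_k`. -/
noncomputable def completeHomog {k : ℕ} (m : ℕ) (a : Fin k → ℂ) : ℂ :=
  MvPolynomial.eval a (MvPolynomial.hsymm (Fin k) ℂ m)

/-- The `m`-th term of the limiting series. -/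
noncomputable def limitTerm {k : ℕ} (a : Fin k → ℂ) (m : ℕ) : ℂ :=
  (-1) ^ m * Complex.I ^ (k + m) / ((m + k + 1).factorial : ℂ) * completeHomog m a * ∏ j, a j

/-!
The moment has a closed form for every `N`. Put `x_r = e^{-i α_r}` and let `z_1, …, z_N` be the
eigenvalues of `U`. At the eigenangle of `z_n` the product of the characteristic polynomials is
`∏_r ∏_l (1 - x_r z_l / z_n)`, and the sum over `n` is a symmetric polynomial in the eigenvalues
times a power of `(det U)⁻¹`. Its mean is (`shiftedMoment_eq`)
`(1/N) ∏_r (1 - x_r) ∑_{d < N} H_d(x)`, where `H_d(x)` is the sum of all monomials of degree at most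
`d` in the `x_r`.

*Weyl's formula* (`haarMean_eq_coeff`). For a symmetric polynomial `f`, the mean of
`f(z) (det U)⁻ᵐ` is the coefficient of `∏_i X_i ^ (i + m)`, `0 ≤ i < N`, in `a f`, where `a` is the
Vandermonde polynomial. No integration over a maximal torus is needed. Invariance of Haar measure
under one-parameter groups says that divergences have mean zero; applied to
`U ^ k ∏_c tr (U ^ l_c) (det U)⁻ᵐ` this is `loop_equation`. These relations say precisely that the
image of `f ↦ a⁻¹ L (a f)` has mean zero, where `L = radialOp m` acts diagonally on monomials
(`radialOp_vandermonde_mul_psumProd`). The kernel of `L` on alternating polynomials is spanned by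
`a (∏ X_i) ^ m` (`exists_perm_of_radialEigenvalue_eq_zero`), and on that line the mean is known
because `(∏ X_i) ^ m` cancels `(det U)⁻ᵐ`.

*The coefficient* (`haarMean_momentPoly`). In the summand with distinguished index `n`, the factor
for `x_r` is `(1 - x_r) X_n` times `∏_{l ≠ n} (X_n - x_r X_l)`. Multiplication by the latter product
acts on coefficients whose exponents, away from `n`, fill an interval with one hole: antisymmetry
in the variables other than `X_n` kills everything but moving the hole up by some `i`, which costs
`(-x_r) ^ i` (`coeff_mul_crossFactor`). Iterating over `r` produces the sums `H_d(x)`.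

*The limit.* Writing `x_r = 1 + y_r`, Pascal's rule gives
`∑_{d < N} H_d(x) = ∑_m h_m(y) (N + k).choose (m + k + 1)` (`sum_truncGeom_one_add`). For
`α_r = a_r / N` the variables `N y_r` tend to `-i a_r`, uniformly on bounded sets, and
`(N + k).choose (m + k + 1) / N ^ (m + k + 1)` tends to `1 / (m + k + 1)!` under a bound summable
against `h_m`. Dominated convergence for series, applied jointly in `N` and `a`
(`tendsto_scaledMoment`), and compactness of the polydisc give the uniform limit.
-/

/-! ### Invariance of Haar measure along one-parameter groups -/

/-- The one-parameter group `t ↦ exp (tX)` of unitary matrices with skew-Hermitian generator `X`. -/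
noncomputable def expUnitary {N : ℕ} {X : Matrix (Fin N) (Fin N) ℂ}
    (hX : X ∈ skewAdjoint (Matrix (Fin N) (Fin N) ℂ)) (t : ℝ) : UnitaryN N :=
  ⟨NormedSpace.exp (t • X), by
    have h : star (NormedSpace.exp (t • X)) = NormedSpace.exp (-(t • X)) := by
      rw [Matrix.star_eq_conjTranspose, ← Matrix.exp_conjTranspose, ← Matrix.star_eq_conjTranspose,
        skewAdjoint.mem_iff.mp (skewAdjoint.smul_mem t hX)]
    have hc : Commute (t • X) (-(t • X)) := (Commute.refl _).neg_right
    rw [Matrix.mem_unitaryGroup_iff, h, ← Matrix.exp_add_of_commute _ _ hc, add_neg_cancel,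
      NormedSpace.exp_zero]⟩

lemma expUnitary_add {N : ℕ} {X : Matrix (Fin N) (Fin N) ℂ}
    (hX : X ∈ skewAdjoint (Matrix (Fin N) (Fin N) ℂ)) (s t : ℝ) :
    expUnitary hX (s + t) = expUnitary hX s * expUnitary hX t := by
  apply Subtype.ext
  change NormedSpace.exp ((s + t) • X) = NormedSpace.exp (s • X) * NormedSpace.exp (t • X)
  rw [add_smul, Matrix.exp_add_of_commute]
  exact ((Commute.refl X).smul_left s).smul_right t

instance instIsMulLeftInvariantHaarUnitary (N : ℕ) : (haarUnitary N).IsMulLeftInvariant := by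
  unfold haarUnitary; infer_instance

lemma integrable_haarUnitary {N : ℕ} {h : UnitaryN N → ℂ} (hc : Continuous h) :
    Integrable h (haarUnitary N) := by
  refine Integrable.of_bound (C := ⨆ U, ‖h U‖) ?_ ?_
  · exact hc.measurable.aestronglyMeasurable
  · exact Filter.Eventually.of_forall fun U =>
      le_ciSup (isCompact_range hc.norm).bddAbove U

/-- Differentiating `∫ h (exp(tX) U) dU = ∫ h(U) dU` at `t = 0`. -/
lemma integral_deriv_expUnitary_eq_zero {N : ℕ} {X : Matrix (Fin N) (Fin N) ℂ}
    (hX : X ∈ skewAdjoint (Matrix (Fin N) (Fin N) ℂ)) {h h' : UnitaryN N → ℂ}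
    (hc : Continuous h) (hc' : Continuous h')
    (hd : ∀ U, HasDerivAt (fun t : ℝ => h (expUnitary hX t * U)) (h' U) 0) :
    ∫ U, h' U ∂(haarUnitary N) = 0 := by
  obtain ⟨C, hC⟩ : ∃ C, ∀ U, ‖h' U‖ ≤ C := by
    obtain ⟨C, hC⟩ := (isCompact_range hc'.norm).bddAbove
    exact ⟨C, fun U => hC ⟨U, rfl⟩⟩
  have key := hasDerivAt_integral_of_dominated_loc_of_deriv_le (μ := haarUnitary N)
    (F := fun (t : ℝ) U => h (expUnitary hX t * U))
    (F' := fun (t : ℝ) U => h' (expUnitary hX t * U)) (x₀ := (0 : ℝ)) (s := Set.univ)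
    (bound := fun _ => C) Filter.univ_mem
    (Filter.Eventually.of_forall fun t =>
      (integrable_haarUnitary (hc.comp (continuous_const_mul _))).aestronglyMeasurable)
    (integrable_haarUnitary (hc.comp (continuous_const_mul _)))
    (integrable_haarUnitary (hc'.comp (continuous_const_mul _))).aestronglyMeasurable
    (Filter.Eventually.of_forall fun U t _ => hC _) (integrable_const _)
    (Filter.Eventually.of_forall fun U t _ => by
      have h1 := hd (expUnitary hX t * U)
      have h2 : HasDerivAt (fun s : ℝ => s - t) 1 t := (hasDerivAt_id t).sub_const t
      rw [← sub_self t] at h1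
      have h3 := HasDerivAt.scomp (h := fun s : ℝ => s - t) t h1 h2
      simp only [one_smul] at h3
      refine h3.congr_of_eventuallyEq (Filter.Eventually.of_forall fun s => ?_)
      simp only [Function.comp]
      rw [← mul_assoc, ← expUnitary_add, sub_add_cancel])
  have h1 : (fun t : ℝ => ∫ U, h (expUnitary hX t * U) ∂(haarUnitary N)) =
      fun _ => ∫ U, h U ∂(haarUnitary N) := by
    funext t
    exact integral_mul_left_eq_self h _
  have h2 := key.2
  rw [h1] at h2
  have h3 := h2.unique (hasDerivAt_const _ _)
  rw [integral_mul_left_eq_self h'] at h3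
  exact h3

/-- Integration by parts on `U(N)`: a derivative that is complex linear in the direction has mean
zero in every complex direction, since these are complex combinations of skew-Hermitian ones. -/
lemma integral_derivative_eq_zero {N : ℕ} {h : UnitaryN N → ℂ}
    (ℓ : UnitaryN N → Matrix (Fin N) (Fin N) ℂ →ₗ[ℂ] ℂ)
    (hc : Continuous h) (hc' : ∀ X, Continuous fun U => ℓ U X)
    (hd : ∀ (X : Matrix (Fin N) (Fin N) ℂ) (hX : X ∈ skewAdjoint (Matrix (Fin N) (Fin N) ℂ)) U,
      HasDerivAt (fun t : ℝ => h (expUnitary hX t * U)) (ℓ U X) 0)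
    (X : Matrix (Fin N) (Fin N) ℂ) : ∫ U, ℓ U X ∂(haarUnitary N) = 0 := by
  have hs : ∀ Y ∈ skewAdjoint (Matrix (Fin N) (Fin N) ℂ), ∫ U, ℓ U Y ∂(haarUnitary N) = 0 :=
    fun Y hY => integral_deriv_expUnitary_eq_zero hY hc (hc' Y) (hd Y hY)
  have hA : (1 / 2 : ℂ) • (X - star X) ∈ skewAdjoint (Matrix (Fin N) (Fin N) ℂ) := by
    rw [skewAdjoint.mem_iff, star_smul, star_sub, star_star, ← smul_neg, neg_sub]
    simp
  have hB : (-Complex.I / 2) • (X + star X) ∈ skewAdjoint (Matrix (Fin N) (Fin N) ℂ) := by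
    rw [skewAdjoint.mem_iff, star_smul, star_add, star_star, ← neg_smul, add_comm (star X)]
    congr 1
    simp [neg_div]
  have hX : X = (1 / 2 : ℂ) • (X - star X) + Complex.I • ((-Complex.I / 2) • (X + star X)) := by
    rw [smul_smul, show Complex.I * (-Complex.I / 2) = 1 / 2 by
      rw [mul_div_assoc', mul_neg, Complex.I_mul_I, neg_neg], ← smul_add]
    rw [show X - star X + (X + star X) = (2 : ℂ) • X by rw [two_smul]; abel, smul_smul]
    norm_num
  rw [hX]
  have hi := integral_add (integrable_haarUnitary (hc' ((1 / 2 : ℂ) • (X - star X))))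
    ((integrable_haarUnitary (hc' ((-Complex.I / 2) • (X + star X)))).smul Complex.I)
  simp only [Pi.smul_apply] at hi
  rw [integral_smul, hs _ hA, hs _ hB, smul_zero, add_zero] at hi
  rw [← hi]
  simp_rw [map_add, map_smul (ℓ _) Complex.I]

/-! ### The loop equations -/

section Derivatives

variable {N : ℕ}

lemma expUnitary_zero {X : Matrix (Fin N) (Fin N) ℂ}
    (hX : X ∈ skewAdjoint (Matrix (Fin N) (Fin N) ℂ)) : expUnitary hX 0 = 1 := by
  apply Subtype.ext
  change NormedSpace.exp ((0 : ℝ) • X) = 1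
  rw [zero_smul, NormedSpace.exp_zero]

open scoped Matrix.Norms.Operator in
lemma hasDerivAt_exp_smul_apply (X : Matrix (Fin N) (Fin N) ℂ) (p q : Fin N) :
    HasDerivAt (fun t : ℝ => (NormedSpace.exp (t • X) : Matrix (Fin N) (Fin N) ℂ) p q)
      (X p q) 0 := by
  have h1 := hasDerivAt_exp_smul_const X (0 : ℝ)
  have h := ((Matrix.entryLinearMap ℝ ℂ p q).toContinuousLinearMap).hasFDerivAt.comp_hasDerivAt
    (0 : ℝ) h1
  refine HasDerivAt.congr_deriv h ?_
  rw [zero_smul]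
  have h2 : (NormedSpace.exp (0 : Matrix (Fin N) (Fin N) ℂ)) * X = X := by
    rw [NormedSpace.exp_zero, one_mul]
  exact congrFun (congrFun h2 p) q

lemma hasDerivAt_matrix_mul_apply {A B : ℝ → Matrix (Fin N) (Fin N) ℂ}
    {A' B' : Matrix (Fin N) (Fin N) ℂ} {x : ℝ}
    (hA : ∀ p q, HasDerivAt (fun t => A t p q) (A' p q) x)
    (hB : ∀ p q, HasDerivAt (fun t => B t p q) (B' p q) x) (p q : Fin N) :
    HasDerivAt (fun t => (A t * B t) p q) ((A' * B x + A x * B') p q) x := by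
  simp only [Matrix.mul_apply, Matrix.add_apply, ← Finset.sum_add_distrib]
  exact HasDerivAt.fun_sum fun j _ => (hA p j).mul (hB j q)

lemma hasDerivAt_expUnitary_mul_apply {X : Matrix (Fin N) (Fin N) ℂ}
    (hX : X ∈ skewAdjoint (Matrix (Fin N) (Fin N) ℂ)) (U : UnitaryN N) (p q : Fin N) :
    HasDerivAt (fun t : ℝ => ((expUnitary hX t * U : UnitaryN N) : Matrix (Fin N) (Fin N) ℂ) p q)
      ((X * (U : Matrix (Fin N) (Fin N) ℂ)) p q) 0 := by
  have h := hasDerivAt_matrix_mul_apply (hasDerivAt_exp_smul_apply X) (B := fun _ => U) (B' := 0)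
    (fun p q => hasDerivAt_const _ _) p q
  simpa using! h

lemma hasDerivAt_pow_apply {X : Matrix (Fin N) (Fin N) ℂ}
    (hX : X ∈ skewAdjoint (Matrix (Fin N) (Fin N) ℂ)) (U : UnitaryN N) (k : ℕ) (p q : Fin N) :
    HasDerivAt
      (fun t : ℝ => (((expUnitary hX t * U : UnitaryN N) : Matrix (Fin N) (Fin N) ℂ) ^ k) p q)
      ((∑ i ∈ Finset.range k, (U : Matrix (Fin N) (Fin N) ℂ) ^ i * X *
        (U : Matrix (Fin N) (Fin N) ℂ) ^ (k - i)) p q) 0 := by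
  induction k generalizing p q with
  | zero => simpa using hasDerivAt_const (0 : ℝ) ((1 : Matrix (Fin N) (Fin N) ℂ) p q)
  | succ k ih =>
    have h := hasDerivAt_matrix_mul_apply ih (hasDerivAt_expUnitary_mul_apply hX U) p q
    simp only [expUnitary_zero, one_mul] at h
    simp_rw [pow_succ _ k]
    refine h.congr_deriv (congrFun (congrFun ?_ p) q)
    rw [Finset.sum_range_succ, Finset.sum_mul, Nat.add_sub_cancel_left, pow_one, mul_assoc _ X]
    congr 1
    refine Finset.sum_congr rfl fun i hi => ?_
    rw [mul_assoc, ← pow_succ, Nat.sub_add_comm (Finset.mem_range.mp hi).le]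

lemma hasDerivAt_trace_pow {X : Matrix (Fin N) (Fin N) ℂ}
    (hX : X ∈ skewAdjoint (Matrix (Fin N) (Fin N) ℂ)) (U : UnitaryN N) (l : ℕ) :
    HasDerivAt
      (fun t : ℝ => (((expUnitary hX t * U : UnitaryN N) : Matrix (Fin N) (Fin N) ℂ) ^ l).trace)
      (l * (X * (U : Matrix (Fin N) (Fin N) ℂ) ^ l).trace) 0 := by
  have h : HasDerivAt
      (fun t : ℝ => (((expUnitary hX t * U : UnitaryN N) : Matrix (Fin N) (Fin N) ℂ) ^ l).trace) _ 0 :=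
    HasDerivAt.fun_sum fun p _ => hasDerivAt_pow_apply hX U l p p
  refine h.congr_deriv ?_
  simp_rw [Matrix.sum_apply]
  rw [Finset.sum_comm]
  have : ∀ i ∈ Finset.range l, ∑ p, ((U : Matrix (Fin N) (Fin N) ℂ) ^ i * X *
        (U : Matrix (Fin N) (Fin N) ℂ) ^ (l - i)) p p =
        (X * (U : Matrix (Fin N) (Fin N) ℂ) ^ l).trace := fun i hi => by
    change Matrix.trace _ = _
    rw [mul_assoc, Matrix.trace_mul_comm, mul_assoc, ← pow_add,
      Nat.sub_add_cancel (Finset.mem_range.mp hi).le]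
  rw [Finset.sum_congr rfl this]
  simp

/-- Jacobi's formula at the identity. -/
lemma hasDerivAt_det_of_eq_one {M : ℝ → Matrix (Fin N) (Fin N) ℂ} {X : Matrix (Fin N) (Fin N) ℂ}
    (h0 : M 0 = 1) (hM : ∀ p q, HasDerivAt (fun t => M t p q) (X p q) 0) :
    HasDerivAt (fun t => (M t).det) X.trace 0 := by
  simp_rw [Matrix.det_apply]
  have h : HasDerivAt (fun t => ∑ σ : Equiv.Perm (Fin N), Equiv.Perm.sign σ • ∏ i, M t (σ i) i)
      (∑ σ : Equiv.Perm (Fin N), Equiv.Perm.sign σ •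
        ∑ i, (∏ j ∈ Finset.univ.erase i, M 0 (σ j) j) • X (σ i) i) 0 := by
    refine HasDerivAt.fun_sum fun σ _ => ?_
    have := HasDerivAt.fun_finsetProd (u := Finset.univ) (f := fun i t => M t (σ i) i)
      (fun i _ => hM (σ i) i)
    have h2 := this.const_mul (((Equiv.Perm.sign σ : ℤ) : ℂ))
    simpa [Units.smul_def] using! h2
  refine h.congr_deriv ?_
  rw [Finset.sum_eq_single (1 : Equiv.Perm (Fin N))]
  · simp [h0, Matrix.trace]
  · intro σ _ hσ
    -- a permutation other than the identity moves at least two points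
    obtain ⟨i, hi⟩ : ∃ i, σ i ≠ i := by
      by_contra! hcon
      exact hσ (Equiv.ext hcon)
    rw [Finset.sum_eq_zero, smul_zero]
    intro j _
    obtain ⟨c, hcj, hc⟩ : ∃ c, c ≠ j ∧ σ c ≠ c := by
      by_cases hij : i = j
      · exact ⟨σ i, hij ▸ hi, fun h => hi (σ.injective h)⟩
      · exact ⟨i, hij, hi⟩
    rw [Finset.prod_eq_zero (Finset.mem_erase.mpr ⟨hcj, Finset.mem_univ c⟩), zero_smul]
    rw [h0, Matrix.one_apply_ne hc]
  · simp

lemma hasDerivAt_star_det_pow {X : Matrix (Fin N) (Fin N) ℂ}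
    (hX : X ∈ skewAdjoint (Matrix (Fin N) (Fin N) ℂ)) (U : UnitaryN N) (m : ℕ) :
    HasDerivAt
      (fun t : ℝ => star (((expUnitary hX t * U : UnitaryN N) : Matrix (Fin N) (Fin N) ℂ).det) ^ m)
      (-(m * X.trace * star ((U : Matrix (Fin N) (Fin N) ℂ).det) ^ m)) 0 := by
  have h1 : HasDerivAt (fun t : ℝ => ((expUnitary hX t : UnitaryN N) :
      Matrix (Fin N) (Fin N) ℂ).det) X.trace 0 := by
    apply hasDerivAt_det_of_eq_one
    · rw [expUnitary_zero]; rfl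
    · intro p q
      simpa using hasDerivAt_pow_apply hX 1 1 p q
  have h2 : star X.trace = -X.trace := by
    rw [← Matrix.trace_conjTranspose, ← Matrix.star_eq_conjTranspose, skewAdjoint.mem_iff.mp hX,
      Matrix.trace_neg]
  have h3 := ((h1.mul_const (U : Matrix (Fin N) (Fin N) ℂ).det).star).fun_pow m
  have h4 : (fun t : ℝ => star (((expUnitary hX t * U : UnitaryN N) :
      Matrix (Fin N) (Fin N) ℂ).det) ^ m) = fun t : ℝ => (star (((expUnitary hX t : UnitaryN N) :
      Matrix (Fin N) (Fin N) ℂ).det * (U : Matrix (Fin N) (Fin N) ℂ).det)) ^ m := by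
    funext t
    rw [← Matrix.det_mul]; rfl
  rw [h4]
  refine HasDerivAt.congr_deriv h3 ?_
  rw [expUnitary_zero]
  rcases m with _ | m
  · simp
  · simp only [star_mul, h2, OneMemClass.coe_one, Matrix.det_one, one_mul, Nat.add_sub_cancel]
    rw [pow_succ]
    simp
    ring

end Derivatives

section LoopEquation

variable {N : ℕ} {ι : Type*} [DecidableEq ι]

lemma continuous_trace_pow (l : ℕ) :
    Continuous fun U : UnitaryN N => ((U : Matrix (Fin N) (Fin N) ℂ) ^ l).trace := by
  have : Continuous fun U : UnitaryN N => (U : Matrix (Fin N) (Fin N) ℂ) := continuous_subtype_val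
  fun_prop

lemma continuous_star_det_pow (m : ℕ) :
    Continuous fun U : UnitaryN N => star (U : Matrix (Fin N) (Fin N) ℂ).det ^ m := by
  have : Continuous fun U : UnitaryN N => (U : Matrix (Fin N) (Fin N) ℂ) := continuous_subtype_val
  fun_prop

/-- The derivative of `U ↦ (U ^ k)_{pq} ∏_c tr (U ^ l_c) · conj (det U) ^ m` along `U ↦ XU`, as a
linear form in `X`. On the unitary group `conj (det U)` is the inverse of `det U`. -/
noncomputable def entryDerivative (m k : ℕ) (s : Finset ι) (l : ι → ℕ) (p q : Fin N) (U : UnitaryN N) :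
    Matrix (Fin N) (Fin N) ℂ →ₗ[ℂ] ℂ where
  toFun X :=
    (((∑ i ∈ Finset.range k, (U : Matrix (Fin N) (Fin N) ℂ) ^ i * X *
        (U : Matrix (Fin N) (Fin N) ℂ) ^ (k - i)) p q) *
        ∏ c ∈ s, ((U : Matrix (Fin N) (Fin N) ℂ) ^ l c).trace +
      ((U : Matrix (Fin N) (Fin N) ℂ) ^ k) p q *
        ∑ c ∈ s, (∏ c' ∈ s.erase c, ((U : Matrix (Fin N) (Fin N) ℂ) ^ l c').trace) *
          (l c * (X * (U : Matrix (Fin N) (Fin N) ℂ) ^ l c).trace)) *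
      star (U : Matrix (Fin N) (Fin N) ℂ).det ^ m +
    ((U : Matrix (Fin N) (Fin N) ℂ) ^ k) p q *
        (∏ c ∈ s, ((U : Matrix (Fin N) (Fin N) ℂ) ^ l c).trace) *
      (-(m * X.trace * star (U : Matrix (Fin N) (Fin N) ℂ).det ^ m))
  map_add' X Y := by
    simp only [mul_add, add_mul, Finset.sum_add_distrib, Matrix.add_apply, Matrix.trace_add]
    ring
  map_smul' r X := by
    have h : ∀ c, (∏ c' ∈ s.erase c, ((U : Matrix (Fin N) (Fin N) ℂ) ^ l c').trace) *
          (l c * (r * (X * (U : Matrix (Fin N) (Fin N) ℂ) ^ l c).trace)) =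
        r * ((∏ c' ∈ s.erase c, ((U : Matrix (Fin N) (Fin N) ℂ) ^ l c').trace) *
          (l c * (X * (U : Matrix (Fin N) (Fin N) ℂ) ^ l c).trace)) := fun c => by ring
    simp only [Matrix.mul_smul, Matrix.smul_mul, ← Finset.smul_sum, Matrix.smul_apply,
      Matrix.trace_smul, smul_eq_mul, RingHom.id_apply, h, ← Finset.mul_sum]
    ring

lemma continuous_entryDerivative (m k : ℕ) (s : Finset ι) (l : ι → ℕ) (p q : Fin N)
    (X : Matrix (Fin N) (Fin N) ℂ) : Continuous fun U => entryDerivative m k s l p q U X := by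
  have hU : Continuous fun U : UnitaryN N => (U : Matrix (Fin N) (Fin N) ℂ) :=
    continuous_subtype_val
  simp only [entryDerivative, LinearMap.coe_mk, AddHom.coe_mk]
  have h1 := continuous_star_det_pow (N := N) m
  have h2 : Continuous fun U : UnitaryN N => ((∑ i ∈ Finset.range k,
      (U : Matrix (Fin N) (Fin N) ℂ) ^ i * X *
      (U : Matrix (Fin N) (Fin N) ℂ) ^ (k - i)) p q) :=
    (continuous_finsetSum _ fun i _ =>
      ((hU.pow i).mul continuous_const).mul (hU.pow _)).matrix_elem p q
  have h3 : Continuous fun U : UnitaryN N => ((U : Matrix (Fin N) (Fin N) ℂ) ^ k) p q :=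
    (hU.pow k).matrix_elem p q
  have h4 := continuous_trace_pow (N := N)
  have h5 : ∀ c, Continuous fun U : UnitaryN N =>
      (X * (U : Matrix (Fin N) (Fin N) ℂ) ^ l c).trace := fun c => by fun_prop
  fun_prop

lemma integral_entryDerivative (m k : ℕ) (s : Finset ι) (l : ι → ℕ) (p q : Fin N)
    (X : Matrix (Fin N) (Fin N) ℂ) :
    ∫ U, entryDerivative m k s l p q U X ∂(haarUnitary N) = 0 := by
  have hU : Continuous fun U : UnitaryN N => (U : Matrix (Fin N) (Fin N) ℂ) :=
    continuous_subtype_val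
  refine integral_derivative_eq_zero (h := fun U => ((U : Matrix (Fin N) (Fin N) ℂ) ^ k) p q *
        (∏ c ∈ s, ((U : Matrix (Fin N) (Fin N) ℂ) ^ l c).trace) *
        star (U : Matrix (Fin N) (Fin N) ℂ).det ^ m) _ ?_ ?_ ?_ X
  · exact ((((hU.pow k).matrix_elem p q)).mul
      (continuous_finsetProd _ fun c _ => continuous_trace_pow _)).mul (continuous_star_det_pow m)
  · exact continuous_entryDerivative m k s l p q
  · intro X hX U
    have hF := HasDerivAt.fun_finsetProd (u := s)
      (f := fun c (t : ℝ) =>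
        (((expUnitary hX t * U : UnitaryN N) : Matrix (Fin N) (Fin N) ℂ) ^ l c).trace)
      (fun c _ => hasDerivAt_trace_pow hX U (l c))
    have h := ((hasDerivAt_pow_apply hX U k p q).fun_mul hF).fun_mul (hasDerivAt_star_det_pow hX U m)
    refine h.congr_deriv ?_
    simp only [expUnitary_zero, one_mul, entryDerivative, LinearMap.coe_mk, AddHom.coe_mk,
      smul_eq_mul]

lemma sum_apply_mul_apply (A B : Matrix (Fin N) (Fin N) ℂ) :
    ∑ p, ∑ q, A p q * B q p = (A * B).trace := by
  simp [Matrix.trace, Matrix.mul_apply]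

lemma mul_single_mul_apply (A B : Matrix (Fin N) (Fin N) ℂ) (p q : Fin N) :
    (A * Matrix.single p q (1 : ℂ) * B) p q = A p p * B q q := by
  rw [mul_assoc, Matrix.mul_apply, Finset.sum_eq_single p]
  · simp
  · intro j _ hj
    rw [Matrix.single_mul_apply_of_ne _ _ _ _ _ hj]; simp
  · simp

/-- The loop (Schwinger–Dyson) equation on `U(N)`: the divergence of the matrix valued function
`U ↦ U ^ k ∏_c tr (U ^ l_c) (det U)⁻ᵐ` has mean zero. -/
theorem loop_equation (m k : ℕ) (s : Finset ι) (l : ι → ℕ) :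
    ∫ U : UnitaryN N, star (U : Matrix (Fin N) (Fin N) ℂ).det ^ m *
      ((∑ i ∈ Finset.range k, ((U : Matrix (Fin N) (Fin N) ℂ) ^ i).trace *
          ((U : Matrix (Fin N) (Fin N) ℂ) ^ (k - i)).trace) *
          ∏ c ∈ s, ((U : Matrix (Fin N) (Fin N) ℂ) ^ l c).trace +
        ∑ c ∈ s, l c * ((U : Matrix (Fin N) (Fin N) ℂ) ^ (k + l c)).trace *
          ∏ c' ∈ s.erase c, ((U : Matrix (Fin N) (Fin N) ℂ) ^ l c').trace -
        m * ((U : Matrix (Fin N) (Fin N) ℂ) ^ k).trace *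
          ∏ c ∈ s, ((U : Matrix (Fin N) (Fin N) ℂ) ^ l c).trace) ∂(haarUnitary N) = 0 := by
  have h0 : ∑ p, ∑ q, ∫ U, entryDerivative m k s l p q U (Matrix.single p q (1 : ℂ))
      ∂(haarUnitary N) = 0 := by simp [integral_entryDerivative]
  have hint : ∀ p q (X : Matrix (Fin N) (Fin N) ℂ), Integrable
      (fun U => entryDerivative m k s l p q U X) (haarUnitary N) := fun p q X =>
    integrable_haarUnitary (continuous_entryDerivative m k s l p q X)
  rw [← h0]
  simp_rw [← integral_finsetSum _ fun q _ => hint _ q _]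
  rw [← integral_finsetSum _ fun p _ => integrable_finsetSum _ fun q _ => hint _ _ _]
  congr 1
  funext U
  simp only [entryDerivative, LinearMap.coe_mk, AddHom.coe_mk]
  set W : Matrix (Fin N) (Fin N) ℂ := (U : Matrix (Fin N) (Fin N) ℂ)
  have h1 : ∑ p, ∑ q, (∑ i ∈ Finset.range k, W ^ i * Matrix.single p q (1 : ℂ) * W ^ (k - i) :
      Matrix (Fin N) (Fin N) ℂ) p q =
      ∑ i ∈ Finset.range k, (W ^ i).trace * (W ^ (k - i)).trace := by
    simp only [Matrix.sum_apply, mul_single_mul_apply, Matrix.trace, Matrix.diag_apply,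
      Finset.sum_mul_sum]
    rw [Finset.sum_comm]
    refine (Finset.sum_congr rfl fun q _ => Finset.sum_comm).trans ?_
    rw [Finset.sum_comm]
    exact Finset.sum_congr rfl fun i _ => Finset.sum_comm
  have h2 : ∀ c, ∑ p, ∑ q, (W ^ k) p q * (Matrix.single p q (1 : ℂ) * W ^ l c).trace =
      (W ^ (k + l c)).trace := fun c => by
    rw [pow_add, ← sum_apply_mul_apply]
    simp [Matrix.trace_single_mul]
  have h3 : ∑ p, ∑ q, (W ^ k) p q * (Matrix.single p q (1 : ℂ)).trace = (W ^ k).trace := by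
    have := sum_apply_mul_apply (W ^ k) 1
    rw [mul_one] at this
    rw [← this]
    refine Finset.sum_congr rfl fun p _ => Finset.sum_congr rfl fun q _ => ?_
    congr 1
    rw [← one_smul ℂ ((1 : Matrix (Fin N) (Fin N) ℂ) q p), ← Matrix.trace_single_mul, mul_one]
  set F := ∏ c ∈ s, (W ^ l c).trace
  set D := star W.det ^ m
  set P : ι → ℂ := fun c => ∏ c' ∈ s.erase c, (W ^ l c').trace
  have h4 : ∀ p q, ((∑ i ∈ Finset.range k,
        W ^ i * Matrix.single p q (1 : ℂ) * W ^ (k - i)) p q * F +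
      (W ^ k) p q * ∑ c ∈ s, P c * (l c * (Matrix.single p q (1 : ℂ) * W ^ l c).trace)) * D +
      (W ^ k) p q * F * (-(m * (Matrix.single p q (1 : ℂ)).trace * D)) =
      D * F * (∑ i ∈ Finset.range k, W ^ i * Matrix.single p q (1 : ℂ) * W ^ (k - i)) p q +
      ∑ c ∈ s, D * l c * P c * ((W ^ k) p q * (Matrix.single p q (1 : ℂ) * W ^ l c).trace) -
      D * m * F * ((W ^ k) p q * (Matrix.single p q (1 : ℂ)).trace) := fun p q => by
    have : ∑ c ∈ s, D * l c * P c * ((W ^ k) p q * (Matrix.single p q (1 : ℂ) * W ^ l c).trace) =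
        D * (W ^ k) p q *
          ∑ c ∈ s, P c * (l c * (Matrix.single p q (1 : ℂ) * W ^ l c).trace) := by
      rw [Finset.mul_sum]
      exact Finset.sum_congr rfl fun c _ => by ring
    rw [this]
    ring
  have h5 : ∑ p, ∑ q, ∑ c ∈ s, D * l c * P c *
      ((W ^ k) p q * (Matrix.single p q (1 : ℂ) * W ^ l c).trace) =
      ∑ c ∈ s, D * l c * P c * (W ^ (k + l c)).trace := by
    simp_rw [← h2, Finset.mul_sum]
    refine (Finset.sum_congr rfl fun q _ => Finset.sum_comm).trans ?_
    rw [Finset.sum_comm]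
  refine Eq.trans ?_ (Finset.sum_congr rfl fun p _ => Finset.sum_congr rfl fun q _ => h4 p q).symm
  simp only [Finset.sum_add_distrib, Finset.sum_sub_distrib, h5, ← Finset.mul_sum, h1, h3]
  rw [mul_sub, mul_add, Finset.mul_sum]
  congr 1
  · congr 1
    · ring
    · exact Finset.sum_congr rfl fun c _ => by ring
  · ring

end LoopEquation

/-! ### Eigenvalues and symmetric functions of them -/

section Eigenvalues

variable {N : ℕ}

lemma exists_fin_map_eq_roots (A : Matrix (Fin N) (Fin N) ℂ) :
    ∃ z : Fin N → ℂ, A.charpoly.roots = Finset.univ.val.map z := by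
  have hcard : A.charpoly.roots.card = N := by
    rw [← (IsAlgClosed.splits A.charpoly).natDegree_eq_card_roots,
      Matrix.charpoly_natDegree_eq_dim, Fintype.card_fin]
  obtain ⟨L, hL⟩ := Quot.exists_rep A.charpoly.roots
  rw [← hL] at hcard ⊢
  have hlen : L.length = N := hcard
  subst hlen
  exact ⟨L.get, by rw [Fin.univ_val_map, List.ofFn_get]; rfl⟩

/-- The eigenvalues of a unitary matrix, with multiplicity, in some order. -/
noncomputable def eigenvalue (U : UnitaryN N) : Fin N → ℂ :=
  (exists_fin_map_eq_roots (U : Matrix (Fin N) (Fin N) ℂ)).choose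

lemma roots_charpoly_eq_eigenvalue (U : UnitaryN N) :
    (U : Matrix (Fin N) (Fin N) ℂ).charpoly.roots = Finset.univ.val.map (eigenvalue U) :=
  (exists_fin_map_eq_roots (U : Matrix (Fin N) (Fin N) ℂ)).choose_spec

lemma charpoly_eq_prod_eigenvalue (U : UnitaryN N) :
    (U : Matrix (Fin N) (Fin N) ℂ).charpoly =
      ∏ i, (Polynomial.X - Polynomial.C (eigenvalue U i)) := by
  rw [(IsAlgClosed.splits _).eq_prod_roots_of_monic (Matrix.charpoly_monic _),
    roots_charpoly_eq_eigenvalue, Multiset.map_map]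
  rfl

lemma det_eq_prod_eigenvalue (U : UnitaryN N) :
    (U : Matrix (Fin N) (Fin N) ℂ).det = ∏ i, eigenvalue U i := by
  rw [Matrix.det_eq_prod_roots_charpoly, roots_charpoly_eq_eigenvalue]
  rfl

lemma det_smul_one_sub (U : UnitaryN N) (c : ℂ) :
    (c • (1 : Matrix (Fin N) (Fin N) ℂ) - U).det = ∏ i, (c - eigenvalue U i) := by
  have h := Matrix.eval_charpoly (U : Matrix (Fin N) (Fin N) ℂ) c
  rw [charpoly_eq_prod_eigenvalue, Polynomial.eval_prod] at h
  rw [Matrix.scalar_apply, ← Matrix.smul_one_eq_diagonal] at h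
  simpa using h.symm

/-- The determinant of a polynomial in `U` is the product of its values at the eigenvalues. -/
lemma det_aeval_eq_prod (U : UnitaryN N) (q : Polynomial ℂ) :
    (Polynomial.aeval (U : Matrix (Fin N) (Fin N) ℂ) q).det = ∏ i, q.eval (eigenvalue U i) := by
  let D : Polynomial ℂ →* ℂ := (Matrix.detMonoidHom (n := Fin N) (R := ℂ)).comp
    ((Polynomial.aeval (R := ℂ) (U : Matrix (Fin N) (Fin N) ℂ)).toRingHom.toMonoidHom)
  let E : Polynomial ℂ →* ℂ :=
    { toFun := fun q => ∏ i, q.eval (eigenvalue U i)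
      map_one' := by simp
      map_mul' := fun p q => by simp [Finset.prod_mul_distrib] }
  change D q = E q
  have hlin : ∀ b : ℂ, D (Polynomial.X - Polynomial.C b) = E (Polynomial.X - Polynomial.C b) := by
    intro b
    change (Polynomial.aeval (U : Matrix (Fin N) (Fin N) ℂ) (Polynomial.X - Polynomial.C b)).det =
      ∏ i, (Polynomial.X - Polynomial.C b).eval (eigenvalue U i)
    have h := det_smul_one_sub U b
    rw [← neg_sub, Matrix.det_neg] at h
    simp only [map_sub, Polynomial.aeval_X, Polynomial.aeval_C, Algebra.algebraMap_eq_smul_one,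
      Polynomial.eval_sub, Polynomial.eval_X, Polynomial.eval_C]
    have h2 : ∏ i, (b - eigenvalue U i) = (-1) ^ N * ∏ i, (eigenvalue U i - b) := by
      have h3 : ∏ _i : Fin N, (-1 : ℂ) = (-1) ^ N := by simp
      rw [← h3, ← Finset.prod_mul_distrib]
      exact Finset.prod_congr rfl fun i _ => by ring
    rw [h2, Fintype.card_fin] at h
    exact mul_left_cancel₀ (pow_ne_zero _ (by norm_num)) h
  have hC : ∀ b : ℂ, D (Polynomial.C b) = E (Polynomial.C b) := by
    intro b
    change (Polynomial.aeval (U : Matrix (Fin N) (Fin N) ℂ) (Polynomial.C b)).det =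
      ∏ i, (Polynomial.C b).eval (eigenvalue U i)
    simp [Algebra.algebraMap_eq_smul_one]
  rw [(IsAlgClosed.splits q).eq_prod_roots, map_mul, map_mul, hC, map_multiset_prod,
    map_multiset_prod, Multiset.map_map, Multiset.map_map]
  congr 3
  funext b
  exact hlin b

/-- Power traces are the power sums of the eigenvalues. -/
lemma trace_pow_eq_sum_eigenvalue (U : UnitaryN N) (l : ℕ) :
    ((U : Matrix (Fin N) (Fin N) ℂ) ^ l).trace = ∑ i, eigenvalue U i ^ l := by
  have h : ((U : Matrix (Fin N) (Fin N) ℂ) ^ l).charpoly =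
      ∏ i, (Polynomial.X - Polynomial.C (eigenvalue U i ^ l)) := by
    refine Polynomial.funext fun c => ?_
    have h1 := det_aeval_eq_prod U (Polynomial.C c - Polynomial.X ^ l)
    rw [Matrix.eval_charpoly, Polynomial.eval_prod]
    simp only [map_sub, map_pow, Polynomial.aeval_X, Polynomial.aeval_C, Polynomial.eval_sub,
      Polynomial.eval_C, Polynomial.eval_pow, Polynomial.eval_X] at h1 ⊢
    exact h1
  rw [Matrix.trace_eq_sum_roots_charpoly, h]
  have h2 : (∏ i, (Polynomial.X - Polynomial.C (eigenvalue U i ^ l))).roots =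
      Finset.univ.val.map fun i => eigenvalue U i ^ l := by
    rw [← Polynomial.roots_multiset_prod_X_sub_C (Finset.univ.val.map fun i => eigenvalue U i ^ l),
      Multiset.map_map]
    rfl
  rw [h2]
  rfl

open scoped Matrix.Norms.L2Operator in
lemma norm_eigenvalue (U : UnitaryN N) (i : Fin N) : ‖eigenvalue U i‖ = 1 := by
  have h : eigenvalue U i ∈ spectrum ℂ (U : Matrix (Fin N) (Fin N) ℂ) := by
    rw [Matrix.mem_spectrum_iff_isRoot_charpoly, Polynomial.IsRoot, charpoly_eq_prod_eigenvalue,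
      Polynomial.eval_prod]
    exact Finset.prod_eq_zero (Finset.mem_univ i) (by simp)
  have : Nontrivial (Matrix (Fin N) (Fin N) ℂ) :=
    haveI : Nonempty (Fin N) := ⟨i⟩
    inferInstance
  simpa using spectrum.subset_circle_of_unitary U.2 h

/-- Symmetric polynomials are polynomials in the power sums, by Newton's identities. -/
lemma isSymmetric_mem_adjoin_psum {f : MvPolynomial (Fin N) ℂ} (hf : f.IsSymmetric) :
    f ∈ Algebra.adjoin ℂ (Set.range fun l : ℕ => MvPolynomial.psum (Fin N) ℂ l) := by
  set A := Algebra.adjoin ℂ (Set.range fun l : ℕ => MvPolynomial.psum (Fin N) ℂ l)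
  have hes : ∀ n, MvPolynomial.esymm (Fin N) ℂ n ∈ A := by
    intro n
    induction n using Nat.strong_induction_on with
    | _ n ih =>
      rcases Nat.eq_zero_or_pos n with rfl | hn
      · simp
      · have h := MvPolynomial.mul_esymm_eq_sum (Fin N) ℂ n
        have hmem : (n : MvPolynomial (Fin N) ℂ) * MvPolynomial.esymm (Fin N) ℂ n ∈ A := by
          rw [h]
          refine A.mul_mem (A.pow_mem (A.neg_mem A.one_mem) _) (A.sum_mem fun a ha => ?_)
          exact A.mul_mem (A.mul_mem (A.pow_mem (A.neg_mem A.one_mem) _)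
            (ih _ (Finset.mem_filter.mp ha).2)) (Algebra.subset_adjoin ⟨_, rfl⟩)
        have h2 := A.smul_mem hmem ((n : ℂ)⁻¹)
        rwa [← map_natCast (MvPolynomial.C (σ := Fin N) (R := ℂ)), ← MvPolynomial.smul_eq_C_mul,
          smul_smul, inv_mul_cancel₀ (Nat.cast_ne_zero.mpr hn.ne'), one_smul] at h2
  obtain ⟨p, hp⟩ := MvPolynomial.esymmAlgHom_surjective (σ := Fin N) ℂ (n := N)
    (by simp) ⟨f, hf⟩
  have h := MvPolynomial.esymmAlgHom_apply (σ := Fin N) (R := ℂ) (n := N) p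
  rw [hp] at h
  change f = _ at h
  rw [h, MvPolynomial.aeval_def, MvPolynomial.eval₂_eq]
  exact A.sum_mem fun d _ => A.mul_mem (A.algebraMap_mem _)
    (A.prod_mem fun i _ => A.pow_mem (hes _) _)

lemma eval_eigenvalue_psum (U : UnitaryN N) (l : ℕ) :
    MvPolynomial.eval (eigenvalue U) (MvPolynomial.psum (Fin N) ℂ l) =
      ((U : Matrix (Fin N) (Fin N) ℂ) ^ l).trace := by
  simp [MvPolynomial.psum, trace_pow_eq_sum_eigenvalue]

lemma continuous_eval_eigenvalue {f : MvPolynomial (Fin N) ℂ} (hf : f.IsSymmetric) :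
    Continuous fun U : UnitaryN N => MvPolynomial.eval (eigenvalue U) f := by
  refine Algebra.adjoin_induction (p := fun f _ =>
    Continuous fun U : UnitaryN N => MvPolynomial.eval (eigenvalue U) f) ?_ ?_ ?_ ?_
    (isSymmetric_mem_adjoin_psum hf)
  · rintro _ ⟨l, rfl⟩
    simp_rw [eval_eigenvalue_psum]
    exact continuous_trace_pow l
  · intro r
    simpa [MvPolynomial.algebraMap_eq] using continuous_const
  · intro f g _ _ hf hg
    simpa using! hf.add hg
  · intro f g _ _ hf hg
    simpa using! hf.mul hg

end Eigenvalues

/-! ### The Vandermonde polynomial and Euler operators -/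

section Vandermonde

variable (N : ℕ)

/-- The Vandermonde polynomial `∏_{i < j} (X_j - X_i)`. -/
noncomputable def vandermondePoly : MvPolynomial (Fin N) ℂ :=
  (Matrix.vandermonde fun i : Fin N => (MvPolynomial.X i : MvPolynomial (Fin N) ℂ)).det

variable {N}

/-- The Euler operator `X_i ∂/∂X_i`, which multiplies the monomial `X ^ μ` by `μ i`. -/
noncomputable def euler (i : Fin N) :
    Derivation ℂ (MvPolynomial (Fin N) ℂ) (MvPolynomial (Fin N) ℂ) :=
  (MvPolynomial.X i : MvPolynomial (Fin N) ℂ) • MvPolynomial.pderiv i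

lemma coeff_euler (i : Fin N) (f : MvPolynomial (Fin N) ℂ) (μ : Fin N →₀ ℕ) :
    (euler i f).coeff μ = μ i * f.coeff μ := by
  induction f using MvPolynomial.induction_on' with
  | monomial ν r =>
    change (MvPolynomial.X i * MvPolynomial.pderiv i (MvPolynomial.monomial ν r)).coeff μ = _
    rw [MvPolynomial.X_mul_pderiv_monomial, MvPolynomial.coeff_smul, MvPolynomial.coeff_monomial]
    split_ifs with h
    · simp [h]
    · simp
  | add p q hp hq => simp only [map_add, MvPolynomial.coeff_add, hp, hq, mul_add]

lemma euler_X (i j : Fin N) :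
    euler i (MvPolynomial.X j : MvPolynomial (Fin N) ℂ) = if i = j then MvPolynomial.X j else 0 := by
  change MvPolynomial.X i * MvPolynomial.pderiv i (MvPolynomial.X j) = _
  rw [MvPolynomial.pderiv_X, Pi.single_apply]
  split_ifs with h1 h2 h2
  · simp [h2]
  · exact absurd h1.symm h2
  · exact absurd h2.symm h1
  · simp

lemma euler_psum (i : Fin N) (l : ℕ) :
    euler i (MvPolynomial.psum (Fin N) ℂ l) =
      (l : MvPolynomial (Fin N) ℂ) * MvPolynomial.X i ^ l := by
  simp only [MvPolynomial.psum, map_sum, Derivation.leibniz_pow, euler_X, smul_ite, smul_zero]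
  rw [Finset.sum_ite_eq]
  rcases l with _ | l
  · simp
  · simp [pow_succ]

/-- The logarithmic derivative of a product of eigenvectors of a derivation. -/
lemma Derivation.prod_of_eq_mul {A ι : Type*} [CommRing A] [Algebra ℂ A] (D : Derivation ℂ A A)
    (s : Finset ι) (u q : ι → A) (h : ∀ i ∈ s, D (u i) = u i * q i) :
    D (∏ i ∈ s, u i) = (∏ i ∈ s, u i) * ∑ i ∈ s, q i := by
  classical
  induction s using Finset.induction_on with
  | empty => simp
  | insert a s ha ih =>
    rw [Finset.prod_insert ha, Finset.sum_insert ha, D.leibniz, h a (Finset.mem_insert_self _ _),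
      ih fun i hi => h i (Finset.mem_insert_of_mem hi)]
    simp only [smul_eq_mul]
    ring

/-- The logarithmic derivative of the Vandermonde polynomial along the vector field
`∑ X_n ^ (l + 1) ∂_n`: each factor `X_j - X_i` contributes the geometric sum
`(X_j ^ (l + 1) - X_i ^ (l + 1)) / (X_j - X_i)`. -/
lemma sum_X_pow_mul_euler_vandermonde (l : ℕ) :
    2 * ∑ n, (MvPolynomial.X n : MvPolynomial (Fin N) ℂ) ^ l * euler n (vandermondePoly N) =
      vandermondePoly N * ((∑ c ∈ Finset.range (l + 1),
        MvPolynomial.psum (Fin N) ℂ c * MvPolynomial.psum (Fin N) ℂ (l - c)) -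
        (l + 1) * MvPolynomial.psum (Fin N) ℂ l) := by
  let D : Derivation ℂ (MvPolynomial (Fin N) ℂ) (MvPolynomial (Fin N) ℂ) :=
    ∑ n, (MvPolynomial.X n : MvPolynomial (Fin N) ℂ) ^ l • euler n
  have hD : ∀ f, D f = ∑ n, (MvPolynomial.X n : MvPolynomial (Fin N) ℂ) ^ l * euler n f := by
    intro f
    change Derivation.coeFnAddMonoidHom D f = _
    simp [D, map_sum]
  have hDX : ∀ i, D (MvPolynomial.X i) = MvPolynomial.X i ^ (l + 1) := by
    intro i
    rw [hD]
    simp [euler_X, pow_succ]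
  let q : Fin N → Fin N → MvPolynomial (Fin N) ℂ := fun i j =>
    ∑ c ∈ Finset.range (l + 1), MvPolynomial.X i ^ c * MvPolynomial.X j ^ (l - c)
  have hq : ∀ i j, D (MvPolynomial.X j - MvPolynomial.X i) =
      (MvPolynomial.X j - MvPolynomial.X i) * q i j := by
    intro i j
    have h := (Commute.all (MvPolynomial.X i : MvPolynomial (Fin N) ℂ)
      (MvPolynomial.X j)).geom_sum₂_mul (l + 1)
    simp only [Nat.add_sub_cancel] at h
    rw [map_sub, hDX, hDX]
    simp only [q]
    linear_combination h
  have hqs : ∀ i j, q i j = q j i := by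
    intro i j
    simp only [q]
    rw [← Finset.sum_range_reflect]
    refine Finset.sum_congr rfl fun c hc => ?_
    have := Finset.mem_range.mp hc
    rw [show l + 1 - 1 - c = l - c by omega, show l - (l - c) = c by omega, mul_comm]
  have hlog : D (vandermondePoly N) = vandermondePoly N * ∑ i, ∑ j ∈ Finset.Ioi i, q i j := by
    rw [vandermondePoly, Matrix.det_vandermonde]
    exact D.prod_of_eq_mul _ _ _ fun i _ => D.prod_of_eq_mul _ _ _ fun j _ => hq i j
  have htot : ∑ i, ∑ j, q i j = 2 * (∑ i, ∑ j ∈ Finset.Ioi i, q i j) + ∑ i, q i i := by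
    have h1 : ∀ i, ∑ j, q i j = ∑ j ∈ Finset.Iio i, q i j + q i i + ∑ j ∈ Finset.Ioi i, q i j := by
      intro i
      have : (Finset.univ : Finset (Fin N)) = Finset.Iio i ∪ {i} ∪ Finset.Ioi i := by
        ext j; simp; grind
      rw [this, Finset.sum_union, Finset.sum_union, Finset.sum_singleton]
      · simp
      · rw [Finset.disjoint_left]; intro j; simp
    have h2 : ∑ i, ∑ j ∈ Finset.Iio i, q i j = ∑ i, ∑ j ∈ Finset.Ioi i, q i j := by
      rw [Finset.sum_comm' (t' := Finset.univ) (s' := fun j => Finset.Ioi j)]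
      · exact Finset.sum_congr rfl fun i _ => Finset.sum_congr rfl fun j _ => hqs _ _
      · simp
    simp_rw [h1, Finset.sum_add_distrib, h2]
    ring
  have hall : ∑ i, ∑ j, q i j = ∑ c ∈ Finset.range (l + 1),
      MvPolynomial.psum (Fin N) ℂ c * MvPolynomial.psum (Fin N) ℂ (l - c) := by
    simp only [q, MvPolynomial.psum, Finset.sum_mul_sum]
    rw [Finset.sum_comm]
    refine (Finset.sum_congr rfl fun q _ => Finset.sum_comm).trans ?_
    rw [Finset.sum_comm]
    exact Finset.sum_congr rfl fun i _ => Finset.sum_comm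
  have hdiag : ∑ i, q i i = (l + 1) * MvPolynomial.psum (Fin N) ℂ l := by
    simp only [q, MvPolynomial.psum, Finset.mul_sum]
    refine Finset.sum_congr rfl fun i _ => ?_
    rw [Finset.sum_congr rfl fun c hc => by
      rw [← pow_add, Nat.add_sub_cancel' (Nat.lt_succ_iff.mp (Finset.mem_range.mp hc))]]
    simp
  rw [← hD, hlog, ← hall, htot, hdiag]
  ring

end Vandermonde

section VandermondeCoefficients

variable {N : ℕ}

/-- Alternating polynomials: permuting the variables multiplies by the sign. -/
def IsAlternating (g : MvPolynomial (Fin N) ℂ) : Prop :=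
  ∀ e : Equiv.Perm (Fin N), MvPolynomial.rename e g = ((Equiv.Perm.sign e : ℤ) : ℂ) • g

lemma isAlternating_vandermondePoly : IsAlternating (vandermondePoly N) := by
  intro e
  have h := Matrix.det_permute e
    (Matrix.vandermonde fun i : Fin N => (MvPolynomial.X i : MvPolynomial (Fin N) ℂ))
  rw [vandermondePoly, AlgHom.map_det, MvPolynomial.smul_eq_C_mul]
  rw [map_intCast, ← h]
  congr 1
  ext1 i j
  simp [Matrix.vandermonde_apply]

lemma IsAlternating.mul_isSymmetric {g f : MvPolynomial (Fin N) ℂ} (hg : IsAlternating g)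
    (hf : f.IsSymmetric) : IsAlternating (g * f) := by
  intro e
  rw [map_mul, hg e, hf e, smul_mul_assoc]

lemma IsAlternating.sub {g f : MvPolynomial (Fin N) ℂ} (hg : IsAlternating g)
    (hf : IsAlternating f) : IsAlternating (g - f) := by
  intro e
  rw [map_sub, hg e, hf e, smul_sub]

lemma IsAlternating.coeff_mapDomain {g : MvPolynomial (Fin N) ℂ} (hg : IsAlternating g)
    (e : Equiv.Perm (Fin N)) (μ : Fin N →₀ ℕ) :
    g.coeff (μ.mapDomain e) = (Equiv.Perm.sign e : ℤ) * g.coeff μ := by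
  have h := MvPolynomial.coeff_rename_mapDomain e e.injective g μ
  rw [hg e, MvPolynomial.coeff_smul, smul_eq_mul] at h
  rw [← h, ← mul_assoc, ← Int.cast_mul, ← Units.val_mul, Int.units_mul_self]
  simp

lemma coeff_eq_zero_of_rename_swap {g : MvPolynomial (Fin N) ℂ} {i j : Fin N}
    (hg : MvPolynomial.rename (Equiv.swap i j) g = -g) {μ : Fin N →₀ ℕ} (h : μ i = μ j) :
    g.coeff μ = 0 := by
  have h1 := MvPolynomial.coeff_rename_mapDomain _ (Equiv.swap i j).injective g μ
  have h2 : μ.mapDomain (Equiv.swap i j) = μ := by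
    ext n
    rw [Finsupp.mapDomain_equiv_apply, Equiv.symm_swap]
    rcases eq_or_ne n i with rfl | hi
    · rw [Equiv.swap_apply_left, h]
    · rcases eq_or_ne n j with rfl | hj
      · rw [Equiv.swap_apply_right, h]
      · rw [Equiv.swap_apply_of_ne_of_ne hi hj]
  rw [h2, hg, MvPolynomial.coeff_neg] at h1
  linear_combination -h1 / 2

lemma IsAlternating.rename_swap {g : MvPolynomial (Fin N) ℂ} (hg : IsAlternating g)
    {i j : Fin N} (hij : i ≠ j) : MvPolynomial.rename (Equiv.swap i j) g = -g := by
  rw [hg, Equiv.Perm.sign_swap hij]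
  simp

lemma IsAlternating.coeff_eq_zero {g : MvPolynomial (Fin N) ℂ} (hg : IsAlternating g)
    {μ : Fin N →₀ ℕ} {i j : Fin N} (hij : i ≠ j) (h : μ i = μ j) : g.coeff μ = 0 :=
  coeff_eq_zero_of_rename_swap (hg.rename_swap hij) h

/-- The exponent `(m, m + 1, …, m + N - 1)`. -/
noncomputable def staircase (N m : ℕ) : Fin N →₀ ℕ :=
  Finsupp.equivFunOnFinite.symm fun i => (i : ℕ) + m

@[simp] lemma staircase_apply (m : ℕ) (i : Fin N) : staircase N m i = i + m := rfl

lemma vandermondePoly_eq_sum : vandermondePoly N = ∑ e : Equiv.Perm (Fin N),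
    MvPolynomial.monomial ((staircase N 0).mapDomain e) ((Equiv.Perm.sign e : ℤ) : ℂ) := by
  rw [vandermondePoly, Matrix.det_apply']
  refine Finset.sum_congr rfl fun e _ => ?_
  rw [MvPolynomial.monomial_eq, map_intCast]
  congr 1
  rw [Finsupp.prod_fintype _ _ (fun i => pow_zero _)]
  refine (Finset.prod_congr rfl fun i _ => ?_).trans (Equiv.prod_comp e
    fun i => (MvPolynomial.X i : MvPolynomial (Fin N) ℂ) ^ ((staircase N 0).mapDomain e) i)
  rw [Finsupp.mapDomain_equiv_apply, Equiv.symm_apply_apply, Matrix.vandermonde_apply]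
  simp

lemma exists_perm_of_coeff_vandermondePoly_ne_zero {μ : Fin N →₀ ℕ}
    (h : (vandermondePoly N).coeff μ ≠ 0) :
    ∃ e : Equiv.Perm (Fin N), μ = (staircase N 0).mapDomain e := by
  rw [vandermondePoly_eq_sum, MvPolynomial.coeff_sum] at h
  obtain ⟨e, _, he⟩ := Finset.exists_ne_zero_of_sum_ne_zero h
  rw [MvPolynomial.coeff_monomial] at he
  exact ⟨e, by by_contra hne; exact he (if_neg (Ne.symm hne))⟩

lemma coeff_vandermondePoly_staircase : (vandermondePoly N).coeff (staircase N 0) = 1 := by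
  rw [vandermondePoly_eq_sum, MvPolynomial.coeff_sum,
    Finset.sum_eq_single (1 : Equiv.Perm (Fin N))]
  · simp [MvPolynomial.coeff_monomial]
  · intro e _ he
    rw [MvPolynomial.coeff_monomial, if_neg]
    intro h
    apply he
    ext i
    have h1 := DFunLike.congr_fun h (e i)
    rw [Finsupp.mapDomain_equiv_apply, Equiv.symm_apply_apply] at h1
    simpa using h1.symm
  · simp

lemma sum_euler_vandermondePoly : ∑ n, euler n (vandermondePoly N) =
    MvPolynomial.C (∑ i : Fin N, (i : ℂ)) * vandermondePoly N := by
  ext μ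
  simp only [MvPolynomial.coeff_sum, coeff_euler, MvPolynomial.coeff_C_mul, ← Finset.sum_mul]
  by_cases h : (vandermondePoly N).coeff μ = 0
  · simp [h]
  · obtain ⟨e, rfl⟩ := exists_perm_of_coeff_vandermondePoly_ne_zero h
    congr 1
    rw [← Equiv.sum_comp e]
    simp [Finsupp.mapDomain_equiv_apply]

lemma sum_euler_euler_vandermondePoly : ∑ n, euler n (euler n (vandermondePoly N)) =
    MvPolynomial.C (∑ i : Fin N, (i : ℂ) ^ 2) * vandermondePoly N := by
  ext μ
  simp only [MvPolynomial.coeff_sum, coeff_euler, MvPolynomial.coeff_C_mul, ← mul_assoc,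
    ← Finset.sum_mul]
  by_cases h : (vandermondePoly N).coeff μ = 0
  · simp [h]
  · obtain ⟨e, rfl⟩ := exists_perm_of_coeff_vandermondePoly_ne_zero h
    congr 1
    rw [← Equiv.sum_comp e]
    simp [Finsupp.mapDomain_equiv_apply, sq]

end VandermondeCoefficients

/-! ### The radial part of the Laplacian -/

section RadialOperator

variable {N : ℕ}

/-- The constant normalising `radialOp` so that it kills the monomial `staircase N m`. -/
noncomputable def radialConst (N m : ℕ) : ℂ :=
  ∑ i : Fin N, (((i : ℂ) + m) ^ 2 - (2 * m + N - 1) * ((i : ℂ) + m))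

/-- The operator `∑ (X_n ∂_n)² - (2m + N - 1) ∑ X_n ∂_n - const`, diagonal on monomials. Conjugated
by the Vandermonde polynomial and twisted by `det⁻ᵐ` it is, up to sign, the radial part of the
Laplacian of `U(N)`. -/
noncomputable def radialOp (m : ℕ) (g : MvPolynomial (Fin N) ℂ) : MvPolynomial (Fin N) ℂ :=
  ∑ n, euler n (euler n g) - MvPolynomial.C (2 * m + N - 1 : ℂ) * ∑ n, euler n g -
    MvPolynomial.C (radialConst N m) * g

/-- The eigenvalue of `radialOp` on the monomial of exponent `μ`. -/
noncomputable def radialEigenvalue (m : ℕ) (μ : Fin N →₀ ℕ) : ℂ :=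
  ∑ n, ((μ n : ℂ) ^ 2 - (2 * m + N - 1) * μ n) - radialConst N m

lemma coeff_radialOp (m : ℕ) (g : MvPolynomial (Fin N) ℂ) (μ : Fin N →₀ ℕ) :
    (radialOp m g).coeff μ = radialEigenvalue m μ * g.coeff μ := by
  simp only [radialOp, radialEigenvalue, MvPolynomial.coeff_sub, MvPolynomial.coeff_C_mul,
    MvPolynomial.coeff_sum, coeff_euler, ← mul_assoc, ← Finset.sum_mul, sub_mul,
    Finset.sum_sub_distrib, ← Finset.mul_sum, sq]

lemma radialOp_add (m : ℕ) (g h : MvPolynomial (Fin N) ℂ) :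
    radialOp m (g + h) = radialOp m g + radialOp m h := by
  ext μ
  simp only [MvPolynomial.coeff_add, coeff_radialOp, mul_add]

lemma radialOp_smul (m : ℕ) (r : ℂ) (g : MvPolynomial (Fin N) ℂ) :
    radialOp m (r • g) = r • radialOp m g := by
  ext μ
  simp only [MvPolynomial.coeff_smul, coeff_radialOp, smul_eq_mul]
  ring

/-- The mean of `f (eigenvalues) · (det U)⁻ᵐ` over `U(N)`. -/
noncomputable def haarMean (m : ℕ) (f : MvPolynomial (Fin N) ℂ) : ℂ :=
  ∫ U : UnitaryN N, star (U : Matrix (Fin N) (Fin N) ℂ).det ^ m *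
    MvPolynomial.eval (eigenvalue U) f ∂(haarUnitary N)

lemma integrable_haarMean (m : ℕ) {f : MvPolynomial (Fin N) ℂ} (hf : f.IsSymmetric) :
    Integrable (fun U : UnitaryN N => star (U : Matrix (Fin N) (Fin N) ℂ).det ^ m *
      MvPolynomial.eval (eigenvalue U) f) (haarUnitary N) :=
  integrable_haarUnitary ((continuous_star_det_pow m).mul (continuous_eval_eigenvalue hf))

lemma haarMean_add (m : ℕ) {f g : MvPolynomial (Fin N) ℂ} (hf : f.IsSymmetric)
    (hg : g.IsSymmetric) : haarMean m (f + g) = haarMean m f + haarMean m g := by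
  simp only [haarMean, map_add, mul_add]
  exact integral_add (integrable_haarMean m hf) (integrable_haarMean m hg)

lemma haarMean_smul (m : ℕ) (r : ℂ) (f : MvPolynomial (Fin N) ℂ) :
    haarMean m (r • f) = r * haarMean m f := by
  simp only [haarMean, MvPolynomial.smul_eval]
  rw [← integral_const_mul]
  congr 1
  funext U
  ring

lemma haarMean_sum (m : ℕ) {κ : Type*} (s : Finset κ) (f : κ → MvPolynomial (Fin N) ℂ)
    (hf : ∀ i, (f i).IsSymmetric) : haarMean m (∑ i ∈ s, f i) = ∑ i ∈ s, haarMean m (f i) := by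
  simp only [haarMean, map_sum, Finset.mul_sum]
  exact integral_finsetSum _ fun i _ => integrable_haarMean m (hf i)

variable {ι : Type*}

/-- The product of power sums `∏_{c ∈ s} p_{l c}`. -/
noncomputable def psumProd (N : ℕ) (l : ι → ℕ) (s : Finset ι) : MvPolynomial (Fin N) ℂ :=
  ∏ c ∈ s, MvPolynomial.psum (Fin N) ℂ (l c)

lemma isSymmetric_psumProd (l : ι → ℕ) (s : Finset ι) : (psumProd N l s).IsSymmetric :=
  (MvPolynomial.symmetricSubalgebra (Fin N) ℂ).prod_mem fun _ _ =>
    MvPolynomial.psum_isSymmetric _ _ _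

variable [DecidableEq ι]

lemma psum_mul_psumProd_erase (l : ι → ℕ) {s : Finset ι} {c : ι} (hc : c ∈ s) :
    MvPolynomial.psum (Fin N) ℂ (l c) * psumProd N l (s.erase c) = psumProd N l s :=
  Finset.mul_prod_erase s (fun c => MvPolynomial.psum (Fin N) ℂ (l c)) hc

/-- The symmetric polynomial entering the loop equation: the divergence of `U ^ k ∏ tr (U ^ l_c)`. -/
noncomputable def loopPoly (N m k : ℕ) (l : ι → ℕ) (s : Finset ι) : MvPolynomial (Fin N) ℂ :=
  (∑ i ∈ Finset.range k, MvPolynomial.psum (Fin N) ℂ i * MvPolynomial.psum (Fin N) ℂ (k - i)) *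
      psumProd N l s +
    ∑ c ∈ s, (l c : ℂ) • (MvPolynomial.psum (Fin N) ℂ (k + l c) * psumProd N l (s.erase c)) -
    (m : ℂ) • (MvPolynomial.psum (Fin N) ℂ k * psumProd N l s)

lemma isSymmetric_loopPoly (m k : ℕ) (l : ι → ℕ) (s : Finset ι) :
    (loopPoly N m k l s).IsSymmetric := by
  have hp : ∀ i, (MvPolynomial.psum (Fin N) ℂ i).IsSymmetric := MvPolynomial.psum_isSymmetric _ _
  let S := MvPolynomial.symmetricSubalgebra (Fin N) ℂ
  exact S.sub_mem (S.add_mem (S.mul_mem (S.sum_mem fun i _ => (hp _).mul (hp _))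
    (isSymmetric_psumProd l s)) (S.sum_mem fun c _ => S.smul_mem
      ((hp _).mul (isSymmetric_psumProd l _)) _))
    (S.smul_mem ((hp _).mul (isSymmetric_psumProd l s)) _)

lemma haarMean_loopPoly (m k : ℕ) (l : ι → ℕ) (s : Finset ι) :
    haarMean m (loopPoly N m k l s) = 0 := by
  rw [← loop_equation (N := N) m k s l, haarMean]
  congr 1
  funext U
  congr 1
  simp only [loopPoly, psumProd, map_sub, map_add, map_sum, map_mul, map_prod,
    MvPolynomial.smul_eval, eval_eigenvalue_psum, mul_assoc]

lemma euler_psumProd (n : Fin N) (l : ι → ℕ) (s : Finset ι) :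
    euler n (psumProd N l s) =
      ∑ c ∈ s, (l c : ℂ) • (MvPolynomial.X n ^ l c * psumProd N l (s.erase c)) := by
  induction s using Finset.induction_on with
  | empty => simp [psumProd]
  | insert a s ha ih =>
    rw [psumProd, Finset.prod_insert ha, ← psumProd, Derivation.leibniz, ih, euler_psum,
      Finset.sum_insert ha, Finset.erase_insert ha, add_comm]
    congr 1
    · simp only [smul_eq_mul, MvPolynomial.smul_eq_C_mul, map_natCast]
      ring
    · rw [Finset.smul_sum]
      refine Finset.sum_congr rfl fun c hc => ?_
      have hne : a ≠ c := fun h => ha (h ▸ hc)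
      rw [Finset.erase_insert_of_ne hne, psumProd, psumProd,
        Finset.prod_insert (fun h => ha (Finset.mem_of_mem_erase h))]
      simp only [smul_eq_mul, MvPolynomial.smul_eq_C_mul]
      ring

lemma sum_euler_psumProd (l : ι → ℕ) (s : Finset ι) :
    ∑ n, euler n (psumProd N l s) = (∑ c ∈ s, (l c : ℂ)) • psumProd N l s := by
  simp_rw [euler_psumProd]
  rw [Finset.sum_comm, Finset.sum_smul]
  refine Finset.sum_congr rfl fun c hc => ?_
  rw [← Finset.smul_sum, ← Finset.sum_mul, ← psum_mul_psumProd_erase l hc]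
  rfl

lemma sum_euler_euler_psumProd (l : ι → ℕ) (s : Finset ι) :
    ∑ n, euler n (euler n (psumProd N l s)) =
      ∑ c ∈ s, (l c : ℂ) • ((l c : ℂ) • psumProd N l s +
        ∑ c' ∈ s.erase c, (l c' : ℂ) • (MvPolynomial.psum (Fin N) ℂ (l c + l c') *
          psumProd N l ((s.erase c).erase c'))) := by
  simp_rw [euler_psumProd, map_sum]
  rw [Finset.sum_comm]
  refine Finset.sum_congr rfl fun c hc => ?_
  have h1 : ∀ n, euler n ((l c : ℂ) • (MvPolynomial.X n ^ l c * psumProd N l (s.erase c))) =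
      (l c : ℂ) • ((l c : ℂ) • (MvPolynomial.X n ^ l c * psumProd N l (s.erase c)) +
        ∑ c' ∈ s.erase c, (l c' : ℂ) • (MvPolynomial.X n ^ (l c + l c') *
          psumProd N l ((s.erase c).erase c'))) := by
    intro n
    have h2 : euler n (MvPolynomial.X n ^ l c : MvPolynomial (Fin N) ℂ) =
        (l c : ℂ) • MvPolynomial.X n ^ l c := by
      rw [Derivation.leibniz_pow, euler_X, if_pos rfl]
      rcases l c with _ | k
      · simp
      · rw [MvPolynomial.smul_eq_C_mul]
        simp [pow_succ]
    rw [Derivation.map_smul, Derivation.leibniz, h2, euler_psumProd, Finset.smul_sum, add_comm]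
    congr 2
    · simp only [smul_eq_mul, MvPolynomial.smul_eq_C_mul]; ring
    · refine Finset.sum_congr rfl fun c' _ => ?_
      simp only [smul_eq_mul, MvPolynomial.smul_eq_C_mul, pow_add]; ring
  simp_rw [h1]
  rw [← Finset.smul_sum, Finset.sum_add_distrib, ← Finset.smul_sum, ← Finset.sum_mul,
    Finset.sum_comm]
  congr 2
  · rw [← psum_mul_psumProd_erase l hc]; rfl
  · refine Finset.sum_congr rfl fun c' _ => ?_
    rw [← Finset.smul_sum, ← Finset.sum_mul]; rfl

lemma sum_euler_vandermonde_mul_euler_psumProd (l : ι → ℕ) (s : Finset ι) :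
    2 * ∑ n, euler n (vandermondePoly N) * euler n (psumProd N l s) =
      vandermondePoly N * ∑ c ∈ s, (l c : ℂ) •
        ((∑ i ∈ Finset.range (l c), MvPolynomial.psum (Fin N) ℂ i *
          MvPolynomial.psum (Fin N) ℂ (l c - i)) * psumProd N l (s.erase c) +
          ((N : ℂ) - l c - 1) • psumProd N l s) := by
  simp_rw [euler_psumProd, Finset.mul_sum]
  rw [Finset.sum_comm]
  refine Finset.sum_congr rfl fun c hc => ?_
  have h := sum_X_pow_mul_euler_vandermonde (N := N) (l c)
  rw [Finset.sum_range_succ, Nat.sub_self, MvPolynomial.psum_zero, Fintype.card_fin] at h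
  rw [← psum_mul_psumProd_erase l hc]
  set P := psumProd N l (s.erase c)
  have h2 : ∑ n, 2 * (euler n (vandermondePoly N) * (l c : ℂ) • (MvPolynomial.X n ^ l c * P)) =
      MvPolynomial.C (l c : ℂ) * P *
        (2 * ∑ n, (MvPolynomial.X n : MvPolynomial (Fin N) ℂ) ^ l c *
          euler n (vandermondePoly N)) := by
    rw [Finset.mul_sum, Finset.mul_sum]
    refine Finset.sum_congr rfl fun n _ => ?_
    rw [MvPolynomial.smul_eq_C_mul]
    ring
  rw [h2, h]
  simp only [MvPolynomial.smul_eq_C_mul, map_sub, map_natCast, map_one]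
  ring

lemma radialConst_eq (m : ℕ) : radialConst N m = ∑ i : Fin N, (i : ℂ) ^ 2 -
    (2 * m + N - 1) * ∑ i : Fin N, (i : ℂ) - N * m ^ 2 := by
  have hg : 2 * ∑ i : Fin N, (i : ℂ) = N * (N - 1) := by
    rw [Fin.sum_univ_eq_sum_range (fun i => (i : ℂ)) N]
    clear m
    induction N with
    | zero => simp
    | succ n ih => rw [Finset.sum_range_succ, mul_add, ih]; push_cast; ring
  have : radialConst N m = ∑ i : Fin N, ((i : ℂ) ^ 2 - (2 * m + N - 1) * (i : ℂ) +
      2 * m * (i : ℂ) + (m ^ 2 - (2 * m + N - 1) * m)) := by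
    rw [radialConst]
    exact Finset.sum_congr rfl fun i _ => by ring
  rw [this]
  simp only [Finset.sum_add_distrib, Finset.sum_sub_distrib, ← Finset.mul_sum, Finset.sum_const,
    Finset.card_univ, Fintype.card_fin, nsmul_eq_mul]
  linear_combination (m : ℂ) * hg

/-- The product rule for `radialOp` turns the Vandermonde polynomial times a product of power sums
into the Vandermonde polynomial times a combination of loop equations. The term `loopPoly N m 0`,
which is a multiple of the product itself, supplies the constant. -/
lemma radialOp_vandermonde_mul_psumProd (m : ℕ) (l : ι → ℕ) (s : Finset ι) :
    radialOp m (vandermondePoly N * psumProd N l s) = vandermondePoly N *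
      (∑ c ∈ s, (l c : ℂ) • loopPoly N m (l c) l (s.erase c) -
        (m : ℂ) • loopPoly N m 0 l s) := by
  set F := psumProd N l s with hF
  set a := vandermondePoly N with ha
  set A : ι → MvPolynomial (Fin N) ℂ := fun c => (∑ i ∈ Finset.range (l c),
    MvPolynomial.psum (Fin N) ℂ i * MvPolynomial.psum (Fin N) ℂ (l c - i)) *
      psumProd N l (s.erase c) with hA
  set B : ι → MvPolynomial (Fin N) ℂ := fun c => ∑ c' ∈ s.erase c, (l c' : ℂ) •
    (MvPolynomial.psum (Fin N) ℂ (l c + l c') * psumProd N l ((s.erase c).erase c')) with hB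
  have hL : ∑ c ∈ s, (l c : ℂ) • loopPoly N m (l c) l (s.erase c) =
      ∑ c ∈ s, (l c : ℂ) • A c + ∑ c ∈ s, (l c : ℂ) • B c -
        MvPolynomial.C (m * ∑ c ∈ s, (l c : ℂ)) * F := by
    have h : ∀ c ∈ s, (l c : ℂ) • loopPoly N m (l c) l (s.erase c) =
        (l c : ℂ) • A c + (l c : ℂ) • B c - MvPolynomial.C (m * (l c : ℂ)) * F := by
      intro c hc
      rw [loopPoly, psum_mul_psumProd_erase l hc, smul_sub, smul_add, smul_smul,
        MvPolynomial.smul_eq_C_mul F, mul_comm (l c : ℂ) m]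
    rw [Finset.sum_congr rfl h, Finset.sum_sub_distrib, Finset.sum_add_distrib, ← Finset.sum_mul,
      ← map_sum, Finset.mul_sum]
  have hL0 : loopPoly N m 0 l s =
      MvPolynomial.C (∑ c ∈ s, (l c : ℂ) - m * N) * F := by
    have h : ∀ c ∈ s, (l c : ℂ) • (MvPolynomial.psum (Fin N) ℂ (0 + l c) *
        psumProd N l (s.erase c)) = MvPolynomial.C (l c : ℂ) * F := by
      intro c hc
      rw [zero_add, psum_mul_psumProd_erase l hc, MvPolynomial.smul_eq_C_mul]
    rw [loopPoly, Finset.sum_congr rfl h, ← Finset.sum_mul, ← map_sum, MvPolynomial.psum_zero,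
      Fintype.card_fin, MvPolynomial.smul_eq_C_mul]
    simp only [Finset.range_zero, Finset.sum_empty, zero_mul, zero_add, map_sub, map_mul,
      map_natCast]
    ring
  have hEE : ∑ n, euler n (euler n (a * F)) = a * ∑ n, euler n (euler n F) +
      2 * ∑ n, euler n a * euler n F + F * ∑ n, euler n (euler n a) := by
    rw [Finset.mul_sum, Finset.mul_sum, Finset.mul_sum, ← Finset.sum_add_distrib,
      ← Finset.sum_add_distrib]
    refine Finset.sum_congr rfl fun n _ => ?_
    simp only [Derivation.leibniz, map_add, smul_eq_mul]
    ring
  have hE : ∑ n, euler n (a * F) = a * ∑ n, euler n F + F * ∑ n, euler n a := by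
    rw [Finset.mul_sum, Finset.mul_sum, ← Finset.sum_add_distrib]
    refine Finset.sum_congr rfl fun n _ => ?_
    simp only [Derivation.leibniz, smul_eq_mul]
  have h1 : ∑ n, euler n (euler n F) = MvPolynomial.C (∑ c ∈ s, (l c : ℂ) ^ 2) * F +
      ∑ c ∈ s, (l c : ℂ) • B c := by
    rw [hF, sum_euler_euler_psumProd, map_sum, Finset.sum_mul, ← Finset.sum_add_distrib]
    refine Finset.sum_congr rfl fun c _ => ?_
    rw [smul_add, smul_smul, ← sq, MvPolynomial.smul_eq_C_mul (psumProd N l s)]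
  have h2 : 2 * ∑ n, euler n a * euler n F = a * (∑ c ∈ s, (l c : ℂ) • A c +
      MvPolynomial.C (((N : ℂ) - 1) * ∑ c ∈ s, (l c : ℂ) - ∑ c ∈ s, (l c : ℂ) ^ 2) * F) := by
    rw [hF, ha, sum_euler_vandermonde_mul_euler_psumProd]
    congr 1
    rw [Finset.mul_sum, ← Finset.sum_sub_distrib, map_sum, Finset.sum_mul,
      ← Finset.sum_add_distrib]
    refine Finset.sum_congr rfl fun c _ => ?_
    rw [smul_add, smul_smul, MvPolynomial.smul_eq_C_mul (psumProd N l s)]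
    congr 3
    ring
  rw [radialOp, hEE, hE, h1, h2, hL, hL0, ha, sum_euler_vandermondePoly,
    sum_euler_euler_vandermondePoly, hF, sum_euler_psumProd, radialConst_eq]
  simp only [MvPolynomial.smul_eq_C_mul, map_sub, map_mul, map_add, map_one, map_pow, map_ofNat]
  ring

end RadialOperator

/-! ### The Weyl integration formula -/

section WeylFormula

variable {N : ℕ}

lemma exists_psumProd_of_mem_closure {f : MvPolynomial (Fin N) ℂ}
    (hf : f ∈ Submonoid.closure (Set.range fun l : ℕ => MvPolynomial.psum (Fin N) ℂ l)) :
    ∃ (n : ℕ) (l : Fin n → ℕ), f = psumProd N l Finset.univ := by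
  induction hf using Submonoid.closure_induction with
  | mem x hx =>
    obtain ⟨l, rfl⟩ := hx
    exact ⟨1, fun _ => l, by simp [psumProd]⟩
  | one => exact ⟨0, Fin.elim0, by simp [psumProd]⟩
  | mul x y _ _ hx hy =>
    obtain ⟨n, l, rfl⟩ := hx
    obtain ⟨n', l', rfl⟩ := hy
    exact ⟨n + n', Fin.append l l', by simp [psumProd, Fin.prod_univ_add]⟩

/-- On symmetric functions, the operator `f ↦ a⁻¹ radialOp (a f)`, where `a` is the Vandermonde
polynomial, is well defined and its image has Haar mean zero. -/
lemma exists_radialOp_eq_mul (m : ℕ) {f : MvPolynomial (Fin N) ℂ} (hf : f.IsSymmetric) :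
    ∃ f' : MvPolynomial (Fin N) ℂ, f'.IsSymmetric ∧
      radialOp m (vandermondePoly N * f) = vandermondePoly N * f' ∧ haarMean m f' = 0 := by
  have hmem := isSymmetric_mem_adjoin_psum hf
  rw [← Subalgebra.mem_toSubmodule, Algebra.adjoin_eq_span] at hmem
  clear hf
  induction hmem using Submodule.span_induction with
  | mem x hx =>
    obtain ⟨n, l, rfl⟩ := exists_psumProd_of_mem_closure hx
    have hs : (∑ c, (l c : ℂ) • loopPoly N m (l c) l (Finset.univ.erase c)).IsSymmetric :=
      (MvPolynomial.symmetricSubalgebra (Fin N) ℂ).sum_mem fun c _ =>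
        (isSymmetric_loopPoly m (l c) l _).smul _
    refine ⟨_, hs.sub ((isSymmetric_loopPoly m 0 l Finset.univ).smul (m : ℂ)),
      radialOp_vandermonde_mul_psumProd m l _, ?_⟩
    rw [sub_eq_add_neg, haarMean_add m hs ((isSymmetric_loopPoly m 0 l Finset.univ).smul _).neg,
      ← neg_smul, haarMean_smul, haarMean_loopPoly, haarMean_sum]
    · simp [haarMean_smul, haarMean_loopPoly]
    · exact fun c => (isSymmetric_loopPoly m (l c) l _).smul _
  | zero =>
    refine ⟨0, MvPolynomial.IsSymmetric.zero, ?_, ?_⟩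
    · ext μ; simp [coeff_radialOp]
    · simp [haarMean]
  | add x y _ _ hx hy =>
    obtain ⟨x', hxs, hx1, hx2⟩ := hx
    obtain ⟨y', hys, hy1, hy2⟩ := hy
    refine ⟨x' + y', hxs.add hys, ?_, ?_⟩
    · rw [mul_add, radialOp_add, hx1, hy1, mul_add]
    · rw [haarMean_add m hxs hys, hx2, hy2, add_zero]
  | smul r x _ hx =>
    obtain ⟨x', hxs, hx1, hx2⟩ := hx
    refine ⟨r • x', hxs.smul r, ?_, ?_⟩
    · rw [mul_smul_comm, radialOp_smul, hx1, mul_smul_comm]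
    · rw [haarMean_smul, hx2, mul_zero]

/-- Among `N` distinct natural numbers, the sum of squared distances to the midpoint of
`m, …, m + N - 1` is smallest exactly at these `N` numbers. -/
lemma exists_perm_of_radialEigenvalue_eq_zero {m : ℕ} {μ : Fin N →₀ ℕ}
    (hinj : Function.Injective μ) (h : radialEigenvalue m μ = 0) :
    ∃ e : Equiv.Perm (Fin N), μ = (staircase N m).mapDomain e := by
  -- `q` is the quadratic in question, shifted so that it vanishes at both end points
  let q : ℕ → ℤ := fun x => ((x : ℤ) - m) * (x - (m + N - 1))
  have hsum : ∑ n, q (μ n) = ∑ i : Fin N, q (i + m) := by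
    have hC : ((∑ n, q (μ n) : ℤ) : ℂ) = ((∑ i : Fin N, q (i + m) : ℤ) : ℂ) := by
      rw [radialEigenvalue, radialConst, sub_eq_zero] at h
      push_cast [q]
      have e1 : ∀ x : ℂ, (x - m) * (x - (m + N - 1)) =
          (x ^ 2 - (2 * m + N - 1) * x) + m * (m + N - 1) := fun x => by ring
      simp only [e1, Finset.sum_add_distrib, h]
    exact_mod_cast hC
  set S := Finset.univ.image μ with hS
  have hScard : S.card = N := by
    rw [hS, Finset.card_image_of_injective _ hinj, Finset.card_univ, Fintype.card_fin]
  have hsum2 : ∑ x ∈ S, q x = ∑ x ∈ Finset.Ico m (m + N), q x := by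
    rw [hS, Finset.sum_image fun x _ y _ hxy => hinj hxy, hsum,
      Fin.sum_univ_eq_sum_range (fun i => q (i + m)) N, Finset.sum_Ico_eq_sum_range]
    simp [add_comm]
  have hsub : S ⊆ Finset.Ico m (m + N) := by
    by_contra hcon
    obtain ⟨x, hxS, hxI⟩ := Finset.not_subset.mp hcon
    have h1 := Finset.sum_inter_add_sum_sdiff S (Finset.Ico m (m + N)) q
    have h2 := Finset.sum_inter_add_sum_sdiff (Finset.Ico m (m + N)) S q
    rw [Finset.inter_comm] at h2
    have h3 : 0 < ∑ x ∈ S \ Finset.Ico m (m + N), q x := by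
      refine Finset.sum_pos (fun y hy => ?_) ⟨x, Finset.mem_sdiff.mpr ⟨hxS, hxI⟩⟩
      have hy2 := (Finset.mem_sdiff.mp hy).2
      rw [Finset.mem_Ico] at hy2
      have hN : 0 < N := by
        rw [← hScard]
        exact Finset.card_pos.mpr ⟨x, hxS⟩
      by_cases hym : m ≤ y
      · have : m + N ≤ y := by omega
        exact mul_pos (by omega) (by omega)
      · exact mul_pos_of_neg_of_neg (by omega) (by omega)
    have h4 : ∑ x ∈ Finset.Ico m (m + N) \ S, q x ≤ 0 := by
      refine Finset.sum_nonpos fun y hy => ?_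
      have hy2 := Finset.mem_Ico.mp (Finset.mem_sdiff.mp hy).1
      exact mul_nonpos_of_nonneg_of_nonpos (by omega) (by omega)
    omega
  have hmem : ∀ n, m ≤ μ n ∧ μ n < m + N := fun n =>
    Finset.mem_Ico.mp (hsub (Finset.mem_image_of_mem μ (Finset.mem_univ n)))
  let r : Fin N → Fin N := fun n => ⟨μ n - m, by have := hmem n; omega⟩
  have hr : Function.Injective r := by
    intro x y hxy
    apply hinj
    have h1 : μ x - m = μ y - m := congrArg Fin.val hxy
    have := hmem x
    have := hmem y
    omega
  refine ⟨(Equiv.ofBijective r (Finite.injective_iff_bijective.mp hr)).symm, ?_⟩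
  ext n
  rw [Finsupp.mapDomain_equiv_apply, Equiv.symm_symm, staircase_apply]
  have := hmem n
  simp [r]
  omega

lemma IsAlternating.injective_of_coeff_ne_zero {g : MvPolynomial (Fin N) ℂ} (hg : IsAlternating g)
    {μ : Fin N →₀ ℕ} (h : g.coeff μ ≠ 0) : Function.Injective μ := by
  intro i j hij
  by_contra hne
  exact h (hg.coeff_eq_zero hne hij)

lemma vandermondePoly_ne_zero : vandermondePoly N ≠ 0 := by
  intro h
  have := coeff_vandermondePoly_staircase (N := N)
  simp [h] at this

/-- The product of all the variables is the determinant on the eigenvalues. -/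
lemma haarMean_prod_X_pow (m : ℕ) :
    haarMean m ((∏ i, (MvPolynomial.X i : MvPolynomial (Fin N) ℂ)) ^ m) = 1 := by
  have h : ∀ U : UnitaryN N, star (U : Matrix (Fin N) (Fin N) ℂ).det ^ m *
      MvPolynomial.eval (eigenvalue U) ((∏ i, (MvPolynomial.X i : MvPolynomial (Fin N) ℂ)) ^ m) =
      1 := by
    intro U
    rw [map_pow, map_prod]
    simp only [MvPolynomial.eval_X]
    rw [← det_eq_prod_eigenvalue, ← mul_pow]
    have : star (U : Matrix (Fin N) (Fin N) ℂ).det * (U : Matrix (Fin N) (Fin N) ℂ).det = 1 := by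
      rw [← Matrix.det_conjTranspose, ← Matrix.det_mul, ← Matrix.star_eq_conjTranspose,
        Matrix.mem_unitaryGroup_iff'.mp U.2, Matrix.det_one]
    rw [this, one_pow]
  simp only [haarMean, h]
  simp

lemma prod_X_pow_eq_monomial (m : ℕ) : (∏ i, (MvPolynomial.X i : MvPolynomial (Fin N) ℂ)) ^ m =
    MvPolynomial.monomial (Finsupp.equivFunOnFinite.symm fun _ => m) 1 := by
  rw [MvPolynomial.monomial_eq, Finsupp.prod_fintype _ _ (fun i => pow_zero _), ← Finset.prod_pow]
  simp

lemma coeff_vandermondePoly_mul_prod_X_pow (m : ℕ) : (vandermondePoly N *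
    (∏ i, (MvPolynomial.X i : MvPolynomial (Fin N) ℂ)) ^ m).coeff (staircase N m) = 1 := by
  have hst : staircase N m = staircase N 0 + Finsupp.equivFunOnFinite.symm fun _ => m := by
    ext i
    simp
  rw [prod_X_pow_eq_monomial, hst, MvPolynomial.coeff_mul_monomial,
    coeff_vandermondePoly_staircase, mul_one]

lemma exists_perm_of_coeff_vandermondePoly_mul_prod_X_pow_ne_zero {m : ℕ} {ν : Fin N →₀ ℕ}
    (h : (vandermondePoly N *
      (∏ i, (MvPolynomial.X i : MvPolynomial (Fin N) ℂ)) ^ m).coeff ν ≠ 0) :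
    ∃ e : Equiv.Perm (Fin N), ν = (staircase N m).mapDomain e := by
  rw [prod_X_pow_eq_monomial, MvPolynomial.coeff_mul_monomial'] at h
  split_ifs at h with hle
  · rw [mul_one] at h
    obtain ⟨e, he⟩ := exists_perm_of_coeff_vandermondePoly_ne_zero h
    refine ⟨e, ?_⟩
    ext n
    have h1 := DFunLike.congr_fun he n
    have h2 := hle n
    rw [Finsupp.mapDomain_equiv_apply] at h1 ⊢
    simp only [Finsupp.coe_tsub, Pi.sub_apply, Finsupp.equivFunOnFinite_symm_apply_apply,
      staircase_apply, add_zero] at h1 h2 ⊢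
    omega
  · exact absurd rfl h

lemma haarMean_eq_coeff_of_radialEigenvalue_eq_zero (m : ℕ) {f : MvPolynomial (Fin N) ℂ}
    (hf : f.IsSymmetric)
    (h : ∀ μ, (vandermondePoly N * f).coeff μ ≠ 0 → radialEigenvalue m μ = 0) :
    haarMean m f = (vandermondePoly N * f).coeff (staircase N m) := by
  set c := (vandermondePoly N * f).coeff (staircase N m) with hc
  set P := (∏ i, (MvPolynomial.X i : MvPolynomial (Fin N) ℂ)) ^ m with hP
  have hPs : P.IsSymmetric := by
    intro e
    rw [hP, map_pow, map_prod]
    simp only [MvPolynomial.rename_X]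
    rw [Equiv.prod_comp e fun i => (MvPolynomial.X i : MvPolynomial (Fin N) ℂ)]
  have halt := isAlternating_vandermondePoly.mul_isSymmetric hf
  have halt2 : IsAlternating (vandermondePoly N * f - vandermondePoly N * (c • P)) :=
    halt.sub (isAlternating_vandermondePoly.mul_isSymmetric (hPs.smul c))
  have h0 : vandermondePoly N * f - vandermondePoly N * (c • P) = 0 := by
    ext ν
    rw [MvPolynomial.coeff_zero]
    by_contra hν
    have hperm : ∃ e : Equiv.Perm (Fin N), ν = (staircase N m).mapDomain e := by
      by_cases h1 : (vandermondePoly N * f).coeff ν = 0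
      · apply exists_perm_of_coeff_vandermondePoly_mul_prod_X_pow_ne_zero
        intro h2
        apply hν
        rw [MvPolynomial.coeff_sub, h1, mul_smul_comm, MvPolynomial.coeff_smul, h2]
        simp
      · exact exists_perm_of_radialEigenvalue_eq_zero (halt.injective_of_coeff_ne_zero h1) (h ν h1)
    obtain ⟨e, rfl⟩ := hperm
    apply hν
    rw [halt2.coeff_mapDomain, MvPolynomial.coeff_sub, mul_smul_comm, MvPolynomial.coeff_smul,
      coeff_vandermondePoly_mul_prod_X_pow, ← hc]
    simp
  have hfc : f = c • P := mul_left_cancel₀ vandermondePoly_ne_zero (sub_eq_zero.mp h0)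
  rw [hfc, haarMean_smul, haarMean_prod_X_pow, mul_one]

/-- Weyl's integration formula, in algebraic form: for symmetric `f`, the Haar mean of
`f (eigenvalues) · (det U)⁻ᵐ` is the coefficient of `X_1 ^ m X_2 ^ (m + 1) ⋯ X_N ^ (m + N - 1)` in the
product of `f` with the Vandermonde polynomial. Each nonzero eigenvalue of `radialOp` occurring in
the product is removed in turn by subtracting a polynomial in the image of `radialOp`. -/
theorem haarMean_eq_coeff (m : ℕ) {f : MvPolynomial (Fin N) ℂ} (hf : f.IsSymmetric) :
    haarMean m f = (vandermondePoly N * f).coeff (staircase N m) := by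
  classical
  suffices H : ∀ (S : Finset ℂ) (f : MvPolynomial (Fin N) ℂ), f.IsSymmetric →
      (∀ μ, (vandermondePoly N * f).coeff μ ≠ 0 →
        radialEigenvalue m μ = 0 ∨ radialEigenvalue m μ ∈ S) →
      haarMean m f = (vandermondePoly N * f).coeff (staircase N m) by
    refine H ((vandermondePoly N * f).support.image (radialEigenvalue m)) f hf fun μ hμ =>
      Or.inr (Finset.mem_image_of_mem _ (MvPolynomial.mem_support_iff.mpr hμ))
  intro S
  induction S using Finset.induction_on with
  | empty =>
    intro f hf h
    exact haarMean_eq_coeff_of_radialEigenvalue_eq_zero m hf fun μ hμ => by simpa using h μ hμ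
  | insert t S _ ih =>
    intro f hf h
    rcases eq_or_ne t 0 with rfl | ht
    · refine ih f hf fun μ hμ => ?_
      rcases h μ hμ with h1 | h1
      · exact Or.inl h1
      · rcases Finset.mem_insert.mp h1 with h2 | h2
        · exact Or.inl h2
        · exact Or.inr h2
    obtain ⟨f', hf's, hf'1, hf'2⟩ := exists_radialOp_eq_mul m hf
    have hs := hf's.smul (-t⁻¹)
    have hcoeff : ∀ μ, (vandermondePoly N * (f + -t⁻¹ • f')).coeff μ =
        (1 - t⁻¹ * radialEigenvalue m μ) * (vandermondePoly N * f).coeff μ := by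
      intro μ
      rw [mul_add, mul_smul_comm, ← hf'1, MvPolynomial.coeff_add, MvPolynomial.coeff_smul,
        coeff_radialOp, smul_eq_mul]
      ring
    have hst : radialEigenvalue m (staircase N m) = 0 := by
      simp [radialEigenvalue, radialConst]
    have h1 := ih (f + -t⁻¹ • f') (hf.add hs) fun μ hμ => by
      rw [hcoeff] at hμ
      rcases h μ (right_ne_zero_of_mul hμ) with h1 | h1
      · exact Or.inl h1
      · rcases Finset.mem_insert.mp h1 with h2 | h2
        · exfalso
          apply left_ne_zero_of_mul hμ
          rw [h2, inv_mul_cancel₀ ht, sub_self]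
        · exact Or.inr h2
    rw [hcoeff, hst, haarMean_add m hf hs, haarMean_smul, hf'2] at h1
    simpa using h1

end WeylFormula

/-! ### Extracting the coefficient: a Pieri rule for staircases with a hole -/

section Pieri

variable {N : ℕ}

/-- The exponent which is `u` at position `n` and which, on the other positions in increasing order,
runs through `{0, …, N - 1} \ {s}` (for `n ≤ s`). -/
noncomputable def holeExp (n : Fin N) (s u : ℕ) : Fin N →₀ ℕ :=
  Finsupp.equivFunOnFinite.symm fun l =>
    if l = n then u else if n < l ∧ (l : ℕ) ≤ s then (l : ℕ) - 1 else l

lemma holeExp_apply (n : Fin N) (s u : ℕ) (l : Fin N) : holeExp n s u l =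
    if l = n then u else if n < l ∧ (l : ℕ) ≤ s then (l : ℕ) - 1 else l := rfl

lemma coeff_vandermondePoly_holeExp (n : Fin N) (j : ℕ) (h : (n : ℕ) + j < N) :
    (vandermondePoly N).coeff (holeExp n (n + j) (n + j)) = (-1) ^ j := by
  induction j with
  | zero =>
    rw [pow_zero, ← coeff_vandermondePoly_staircase (N := N)]
    congr 1
    ext l
    rw [holeExp_apply, staircase_apply]
    split_ifs with h1 h2
    · simp [h1]
    · have := Fin.lt_def.mp h2.1
      omega
    · rfl
  | succ j ih =>
    set t : Fin N := ⟨n + (j + 1), h⟩ with ht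
    have hnt : n ≠ t := fun h0 => by
      have := congrArg Fin.val h0
      simp [ht] at this
    have hmap : holeExp n (n + (j + 1)) (n + (j + 1)) =
        (holeExp n (n + j) (n + j)).mapDomain (Equiv.swap n t) := by
      ext l
      rw [Finsupp.mapDomain_equiv_apply, Equiv.symm_swap]
      rcases eq_or_ne l n with rfl | hln
      · rw [Equiv.swap_apply_left, holeExp_apply, holeExp_apply, if_pos rfl, if_neg hnt.symm,
          if_neg]
        simp [ht]
      rcases eq_or_ne l t with rfl | hlt
      · rw [Equiv.swap_apply_right, holeExp_apply, holeExp_apply, if_pos rfl, if_neg hnt.symm,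
          if_pos]
        · simp [ht]
        · simp [ht, Fin.lt_def]
      · rw [Equiv.swap_apply_of_ne_of_ne hln hlt, holeExp_apply, holeExp_apply, if_neg hln,
          if_neg hln]
        have : (l : ℕ) ≠ n + (j + 1) := fun h0 => hlt (Fin.ext h0)
        split_ifs <;> omega
    rw [hmap, isAlternating_vandermondePoly.coeff_mapDomain, Equiv.Perm.sign_swap hnt,
      ih (by omega)]
    simp [pow_succ]

/-- The product `∏_{j ≠ n} (X_n - x X_j)`. -/
noncomputable def crossFactor (n : Fin N) (x : ℂ) : MvPolynomial (Fin N) ℂ :=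
  ∏ j ∈ Finset.univ.erase n, (MvPolynomial.X n - MvPolynomial.C x * MvPolynomial.X j)

/-- The exponent of the monomial of `crossFactor n x` in which the factors `j ∈ S` contribute `X_j`. -/
noncomputable def crossExp (n : Fin N) (S : Finset (Fin N)) : Fin N →₀ ℕ :=
  Finsupp.equivFunOnFinite.symm fun l =>
    if l = n then N - 1 - S.card else if l ∈ S then 1 else 0

lemma crossExp_apply (n : Fin N) (S : Finset (Fin N)) (l : Fin N) : crossExp n S l =
    if l = n then N - 1 - S.card else if l ∈ S then 1 else 0 := rfl

lemma crossFactor_eq_sum (n : Fin N) (x : ℂ) : crossFactor n x =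
    ∑ S ∈ (Finset.univ.erase n).powerset, MvPolynomial.monomial (crossExp n S) ((-x) ^ S.card) := by
  rw [crossFactor, Finset.prod_sub]
  refine Finset.sum_congr rfl fun S hS => ?_
  have hS' := Finset.mem_powerset.mp hS
  have hn : n ∉ S := fun h => by simpa using hS' h
  rw [MvPolynomial.monomial_eq, Finset.prod_const, Finset.card_sdiff_of_subset hS',
    Finset.card_erase_of_mem (Finset.mem_univ n), Finset.card_univ, Fintype.card_fin,
    Finset.prod_mul_distrib, Finset.prod_const, Finsupp.prod_fintype _ _ (fun i => pow_zero _),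
    ← Finset.mul_prod_erase _ _ (Finset.mem_univ n), crossExp_apply, if_pos rfl]
  have h1 : ∏ l ∈ Finset.univ.erase n,
      (MvPolynomial.X l : MvPolynomial (Fin N) ℂ) ^ crossExp n S l = ∏ l ∈ S, MvPolynomial.X l := by
    rw [← Finset.prod_subset hS']
    · refine Finset.prod_congr rfl fun l hl => ?_
      rw [crossExp_apply, if_neg (fun h : l = n => hn (h ▸ hl)), if_pos hl, pow_one]
    · intro l hl hlS
      rw [crossExp_apply, if_neg (Finset.ne_of_mem_erase hl), if_neg hlS, pow_zero]
  rw [h1, map_pow, neg_pow, map_neg, neg_pow (MvPolynomial.C x)]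
  ring

/-- The positions `s + 1, …, s + i`. -/
def holeBlock (N s i : ℕ) : Finset (Fin N) :=
  Finset.univ.filter fun l => s < (l : ℕ) ∧ (l : ℕ) ≤ s + i

lemma card_holeBlock {s i : ℕ} (h : s + i < N) : (holeBlock N s i).card = i := by
  have : (holeBlock N s i).map Fin.valEmbedding = Finset.Ioc s (s + i) := by
    ext v
    simp only [holeBlock, Finset.mem_map, Finset.mem_filter, Finset.mem_univ, true_and,
      Fin.valEmbedding_apply, Finset.mem_Ioc]
    constructor
    · rintro ⟨a, ha, rfl⟩; exact ha
    · intro hv; exact ⟨⟨v, by omega⟩, hv, rfl⟩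
  rw [← Finset.card_map, this, Nat.card_Ioc]
  omega

/-- Subtracting one from a set `S` of entries of a staircase with a hole at `s` leaves distinct
natural numbers only if `S` consists of the entries `s + 1, …, s + i` for some `i`. -/
lemma eq_holeBlock {n : Fin N} {s u : ℕ} (hns : (n : ℕ) ≤ s) (hs : s < N) {S : Finset (Fin N)}
    (hnS : n ∉ S) (hpos : ∀ l ∈ S, 1 ≤ holeExp n s u l)
    (hinj : ∀ l l', l ≠ n → l' ≠ n → l ≠ l' →
      holeExp n s u l - (if l ∈ S then 1 else 0) ≠ holeExp n s u l' - (if l' ∈ S then 1 else 0)) :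
    ∃ i ∈ Finset.range (N - s), S = holeBlock N s i := by
  have hstep : ∀ l ∈ S, ∀ l', l' ≠ n → holeExp n s u l = holeExp n s u l' + 1 → l' ∈ S := by
    intro l hl l' hl' hval
    by_contra hcon
    have hll' : l ≠ l' := fun h => hcon (h ▸ hl)
    have := hinj l l' (fun h => hnS (h ▸ hl)) hl' hll'
    rw [if_pos hl, if_neg hcon] at this
    omega
  have hA : ∀ v (hv : v < N), (⟨v, hv⟩ : Fin N) ∈ S → s < v := by
    intro v
    induction v using Nat.strong_induction_on with
    | _ v ih =>
      intro hv hvS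
      by_contra hvs
      have hvn : (⟨v, hv⟩ : Fin N) ≠ n := fun h => hnS (h ▸ hvS)
      have hvn' : v ≠ n := fun h => hvn (Fin.ext h)
      have hp := hpos _ hvS
      have hst := hstep _ hvS
      rw [holeExp_apply, if_neg hvn] at hp hst
      by_cases hlt : v < n
      · have hnot : ¬(n < (⟨v, hv⟩ : Fin N) ∧ v ≤ s) := by rw [Fin.lt_def]; simp; omega
        rw [if_neg hnot] at hp hst
        have hv1 : v - 1 < N := by omega
        simp only at hp
        have hm := hst ⟨v - 1, hv1⟩ (by intro h; have := congrArg Fin.val h; simp at this; omega)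
          (by
            rw [holeExp_apply, if_neg (by intro h; have := congrArg Fin.val h; simp at this; omega),
              if_neg (by rw [Fin.lt_def]; simp; omega)]
            simp only; omega)
        have := ih (v - 1) (by omega) hv1 hm
        omega
      · have hyes : (n < (⟨v, hv⟩ : Fin N) ∧ v ≤ s) := by rw [Fin.lt_def]; simp; omega
        rw [if_pos hyes] at hp hst
        simp only at hp
        -- the entry one smaller sits at the previous position other than `n`
        by_cases hv1n : v - 1 = n
        · have hv1 : v - 2 < N := by omega
          have hm := hst ⟨v - 2, hv1⟩
            (by intro h; have := congrArg Fin.val h; simp at this; omega)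
            (by
              rw [holeExp_apply,
                if_neg (by intro h; have := congrArg Fin.val h; simp at this; omega),
                if_neg (by rw [Fin.lt_def]; simp; omega)]
              simp only; omega)
          have := ih (v - 2) (by omega) hv1 hm
          omega
        · have hv1 : v - 1 < N := by omega
          have hm := hst ⟨v - 1, hv1⟩
            (by intro h; have := congrArg Fin.val h; simp at this; omega)
            (by
              rw [holeExp_apply,
                if_neg (by intro h; have := congrArg Fin.val h; simp at this; omega),
                if_pos (by rw [Fin.lt_def]; simp; omega)]
              simp only; omega)
          have := ih (v - 1) (by omega) hv1 hm
          omega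
  have hB : ∀ v (hv : v + 1 < N), (⟨v + 1, hv⟩ : Fin N) ∈ S → s < v →
      (⟨v, by omega⟩ : Fin N) ∈ S := by
    intro v hv hvS hsv
    refine hstep _ hvS _ (by intro h; have := congrArg Fin.val h; simp at this; omega) ?_
    rw [holeExp_apply, holeExp_apply,
      if_neg (by intro h; have := congrArg Fin.val h; simp at this; omega),
      if_neg (by simp; omega),
      if_neg (by intro h; have := congrArg Fin.val h; simp at this; omega),
      if_neg (by simp; omega)]
  rcases S.eq_empty_or_nonempty with rfl | hne
  · refine ⟨0, Finset.mem_range.mpr (by omega), ?_⟩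
    ext l
    simp [holeBlock]
  · set M := S.max' hne with hM
    have hMS : M ∈ S := S.max'_mem hne
    have hsM : s < (M : ℕ) := hA M M.2 hMS
    have hdown : ∀ j v (hv : v < N), s < v → v + j = M → (⟨v, hv⟩ : Fin N) ∈ S := by
      intro j
      induction j with
      | zero =>
        intro v hv _ hvM
        have : (⟨v, hv⟩ : Fin N) = M := Fin.ext (by simpa using hvM)
        rwa [this]
      | succ j ih =>
        intro v hv hsv hvM
        have hM2 := M.2
        exact hB v (by omega) (ih (v + 1) (by omega) (by omega) (by omega)) hsv
    have hM2 := M.2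
    refine ⟨M - s, Finset.mem_range.mpr (by omega), ?_⟩
    ext l
    simp only [holeBlock, Finset.mem_filter, Finset.mem_univ, true_and]
    constructor
    · intro hl
      have h1 := hA l l.2 hl
      have h2 : (l : ℕ) ≤ M := Fin.le_def.mp (S.le_max' l hl)
      omega
    · rintro ⟨h1, h2⟩
      exact hdown (M - l) l l.2 h1 (by omega)

/-- Multiplying by `crossFactor` moves the hole of a staircase upwards. -/
lemma coeff_mul_crossFactor {n : Fin N} {g : MvPolynomial (Fin N) ℂ}
    (hg : ∀ i j, i ≠ n → j ≠ n → i ≠ j → MvPolynomial.rename (Equiv.swap i j) g = -g)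
    (x : ℂ) {s : ℕ} (u : ℕ) (hns : (n : ℕ) ≤ s) (hs : s < N) :
    (g * crossFactor n x).coeff (holeExp n s (u + (N - 1))) =
      ∑ i ∈ Finset.range (N - s), (-x) ^ i * g.coeff (holeExp n (s + i) (u + i)) := by
  have hblock : ∀ i, n ∉ holeBlock N s i := fun i h => by
    simp only [holeBlock, Finset.mem_filter] at h
    omega
  have hsub : (Finset.range (N - s)).image (holeBlock N s) ⊆ (Finset.univ.erase n).powerset := by
    intro S hS
    obtain ⟨i, _, rfl⟩ := Finset.mem_image.mp hS
    exact Finset.mem_powerset.mpr fun l hl =>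
      Finset.mem_erase.mpr ⟨fun h => hblock i (h ▸ hl), Finset.mem_univ l⟩
  rw [crossFactor_eq_sum, Finset.mul_sum, MvPolynomial.coeff_sum, ← Finset.sum_subset hsub]
  · rw [Finset.sum_image]
    · refine Finset.sum_congr rfl fun i hi => ?_
      have hi' := Finset.mem_range.mp hi
      have hcard : (holeBlock N s i).card = i := card_holeBlock (by omega)
      have hexp : holeExp n s (u + (N - 1)) =
          holeExp n (s + i) (u + i) + crossExp n (holeBlock N s i) := by
        ext l
        rw [Finsupp.add_apply, holeExp_apply, holeExp_apply, crossExp_apply, hcard]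
        by_cases hl : l = n
        · rw [if_pos hl, if_pos hl, if_pos hl]; omega
        · rw [if_neg hl, if_neg hl, if_neg hl]
          simp only [holeBlock, Finset.mem_filter, Finset.mem_univ, true_and, Fin.lt_def]
          split_ifs <;> omega
      rw [hexp, MvPolynomial.coeff_mul_monomial, hcard, mul_comm]
    · intro i hi j hj hij
      have hi' := Finset.mem_range.mp hi
      have hj' := Finset.mem_range.mp hj
      rw [← card_holeBlock (N := N) (s := s) (i := i) (by omega), hij, card_holeBlock (by omega)]
  · intro S hS hSn
    have hnS : n ∉ S := fun h => by simpa using Finset.mem_powerset.mp hS h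
    rw [MvPolynomial.coeff_mul_monomial']
    split_ifs with hle
    · by_contra hne
      have hcoeff := left_ne_zero_of_mul hne
      apply hSn
      obtain ⟨i, hi, rfl⟩ := eq_holeBlock (u := u + (N - 1)) hns hs hnS
        (fun l hl => by
          have := hle l
          rwa [crossExp_apply, if_neg (fun h : l = n => hnS (h ▸ hl)), if_pos hl] at this)
        (fun l l' hl hl' hll' heq => by
          apply hcoeff
          apply coeff_eq_zero_of_rename_swap (hg l l' hl hl' hll')
          rw [Finsupp.coe_tsub, Pi.sub_apply, Pi.sub_apply, crossExp_apply, crossExp_apply,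
            if_neg hl, if_neg hl', heq])
      exact Finset.mem_image_of_mem _ hi
    · rfl

/-- The sum of the monomials of degree at most `d` in `x_1, …, x_k`. -/
noncomputable def truncGeom : (k : ℕ) → (Fin k → ℂ) → ℕ → ℂ
  | 0, _, _ => 1
  | k + 1, x, d => ∑ i ∈ Finset.range (d + 1),
      x (Fin.last k) ^ i * truncGeom k (fun r => x r.castSucc) (d - i)

lemma rename_swap_crossFactor {n i j : Fin N} (hi : i ≠ n) (hj : j ≠ n) (x : ℂ) :
    MvPolynomial.rename (Equiv.swap i j) (crossFactor n x) = crossFactor n x := by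
  have hn : Equiv.swap i j n = n := Equiv.swap_apply_of_ne_of_ne hi.symm hj.symm
  simp only [crossFactor, map_prod, map_sub, map_mul, MvPolynomial.rename_X, MvPolynomial.rename_C,
    hn]
  refine Finset.prod_nbij' (Equiv.swap i j) (Equiv.swap i j) ?_ ?_ ?_ ?_ ?_
  · intro l hl
    refine Finset.mem_erase.mpr ⟨fun h => ?_, Finset.mem_univ _⟩
    rw [← hn] at h
    exact Finset.ne_of_mem_erase hl ((Equiv.swap i j).injective h)
  · intro l hl
    refine Finset.mem_erase.mpr ⟨fun h => ?_, Finset.mem_univ _⟩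
    rw [← hn] at h
    exact Finset.ne_of_mem_erase hl ((Equiv.swap i j).injective h)
  · intro l _; exact Equiv.swap_apply_self _ _ _
  · intro l _; exact Equiv.swap_apply_self _ _ _
  · intro l _; rfl

lemma coeff_vandermonde_mul_prod_crossFactor (n : Fin N) (k : ℕ) (x : Fin k → ℂ) (j : ℕ)
    (hj : (n : ℕ) + j < N) :
    (vandermondePoly N * ∏ r, crossFactor n (x r)).coeff
      (holeExp n (n + j) (n + j + (N - 1) * k)) =
      (-1) ^ j * truncGeom k x (N - 1 - (n + j)) := by
  induction k generalizing j with
  | zero => simp [truncGeom, coeff_vandermondePoly_holeExp n j hj]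
  | succ k ih =>
    rw [Fin.prod_univ_castSucc, ← mul_assoc, Nat.mul_succ, ← add_assoc, coeff_mul_crossFactor
      ?_ _ _ (Nat.le_add_right _ _) hj, truncGeom, Finset.mul_sum]
    · rw [show N - (n + j) = N - 1 - (n + j) + 1 by omega]
      refine Finset.sum_congr rfl fun i hi => ?_
      have hi' := Finset.mem_range.mp hi
      have h := ih (fun r => x r.castSucc) (j + i) (by omega)
      rw [show (n : ℕ) + j + (N - 1) * k + i = n + (j + i) + (N - 1) * k by ring,
        show (n : ℕ) + j + i = n + (j + i) by ring, h,
        show N - 1 - ((n : ℕ) + (j + i)) = N - 1 - (n + j) - i by omega, neg_pow, pow_add]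
      have : (-1 : ℂ) ^ i * (-1) ^ i = 1 := by rw [← mul_pow]; simp
      linear_combination x (Fin.last k) ^ i * (-1) ^ j *
        truncGeom k (fun r => x r.castSucc) (N - 1 - (n + j) - i) * this
    · intro i l hi hl hil
      rw [map_mul, isAlternating_vandermondePoly.rename_swap hil, map_prod, neg_mul]
      congr 2
      exact Finset.prod_congr rfl fun r _ => rename_swap_crossFactor hi hl _

/-- The symmetric polynomial whose quotient by `(∏ X_l) ^ (N k)` is
`∑_n ∏_r ∏_l (1 - x_r X_l / X_n)`. -/
noncomputable def momentPoly (N k : ℕ) (x : Fin k → ℂ) : MvPolynomial (Fin N) ℂ :=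
  ∑ n, (∏ l ∈ Finset.univ.erase n, MvPolynomial.X l) ^ (N * k) *
    ∏ r, ∏ l, (MvPolynomial.X n - MvPolynomial.C (x r) * MvPolynomial.X l)

lemma isSymmetric_momentPoly (k : ℕ) (x : Fin k → ℂ) : (momentPoly N k x).IsSymmetric := by
  intro e
  simp only [momentPoly, map_sum, map_mul, map_pow, map_prod, map_sub, MvPolynomial.rename_X,
    MvPolynomial.rename_C]
  refine (Finset.sum_congr rfl fun n _ => ?_).trans (Equiv.sum_comp e fun n =>
    (∏ l ∈ Finset.univ.erase n, (MvPolynomial.X l : MvPolynomial (Fin N) ℂ)) ^ (N * k) *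
      ∏ r, ∏ l, (MvPolynomial.X n - MvPolynomial.C (x r) * MvPolynomial.X l))
  congr 1
  · congr 1
    have : (Finset.univ.erase (e n)) = (Finset.univ.erase n).map e.toEmbedding := by
      rw [Finset.map_erase]; simp
    rw [this, Finset.prod_map]
    rfl
  · refine Finset.prod_congr rfl fun r _ => ?_
    exact Equiv.prod_comp e fun l => (MvPolynomial.X (e n) - MvPolynomial.C (x r) *
      MvPolynomial.X l : MvPolynomial (Fin N) ℂ)

lemma momentPoly_summand (n : Fin N) (k : ℕ) (x : Fin k → ℂ) :
    (∏ l ∈ Finset.univ.erase n, (MvPolynomial.X l : MvPolynomial (Fin N) ℂ)) ^ (N * k) *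
      ∏ r, ∏ l, (MvPolynomial.X n - MvPolynomial.C (x r) * MvPolynomial.X l) =
    (∏ r, crossFactor n (x r)) * MvPolynomial.monomial
      (Finsupp.equivFunOnFinite.symm fun l => if l = n then k else N * k) (∏ r, (1 - x r)) := by
  have h1 : ∀ r, ∏ l, (MvPolynomial.X n - MvPolynomial.C (x r) * MvPolynomial.X l) =
      MvPolynomial.C (1 - x r) * MvPolynomial.X n * crossFactor n (x r) := by
    intro r
    rw [← Finset.mul_prod_erase _ _ (Finset.mem_univ n), ← crossFactor, map_sub, map_one]
    ring
  simp_rw [h1]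
  rw [Finset.prod_mul_distrib, Finset.prod_mul_distrib, Finset.prod_const, Finset.card_univ,
    Fintype.card_fin, MvPolynomial.monomial_eq, Finsupp.prod_fintype _ _ (fun i => pow_zero _),
    ← Finset.mul_prod_erase _ _ (Finset.mem_univ n), map_prod, ← Finset.prod_pow]
  have h2 : ∏ l ∈ Finset.univ.erase n, (MvPolynomial.X l : MvPolynomial (Fin N) ℂ) ^
      (Finsupp.equivFunOnFinite.symm (fun l => if l = n then k else N * k) : Fin N →₀ ℕ) l =
      ∏ l ∈ Finset.univ.erase n, (MvPolynomial.X l : MvPolynomial (Fin N) ℂ) ^ (N * k) := by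
    refine Finset.prod_congr rfl fun l hl => ?_
    simp [Finset.ne_of_mem_erase hl]
  rw [h2]
  simp
  ring

/-- By Weyl's formula, the summand of `momentPoly` with distinguished index `n` contributes the partial
sum of degree `N - 1 - n`. -/
theorem haarMean_momentPoly (k : ℕ) (x : Fin k → ℂ) :
    haarMean (N * k) (momentPoly N k x) =
      (∏ r, (1 - x r)) * ∑ d ∈ Finset.range N, truncGeom k x d := by
  rw [haarMean_eq_coeff _ (isSymmetric_momentPoly k x), momentPoly, Finset.mul_sum,
    MvPolynomial.coeff_sum, ← Finset.sum_range_reflect, ← Fin.sum_univ_eq_sum_range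
      (fun j => truncGeom k x (N - 1 - j)) N, Finset.mul_sum]
  refine Finset.sum_congr rfl fun n _ => ?_
  have hexp : staircase N (N * k) = holeExp n (n + 0) (n + 0 + (N - 1) * k) +
      Finsupp.equivFunOnFinite.symm fun l => if l = n then k else N * k := by
    ext l
    rw [Finsupp.add_apply, staircase_apply, holeExp_apply, Finsupp.equivFunOnFinite_symm_apply_apply]
    by_cases h : l = n
    · have hN : N - 1 + 1 = N := by have := n.2; omega
      have hk : (N - 1) * k + k = N * k := by rw [← Nat.succ_mul, Nat.succ_eq_add_one, hN]
      rw [if_pos h, if_pos h, h]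
      omega
    · rw [if_neg h, if_neg h, if_neg]
      rw [Fin.lt_def]
      omega
  rw [momentPoly_summand, ← mul_assoc, hexp, MvPolynomial.coeff_mul_monomial,
    coeff_vandermonde_mul_prod_crossFactor n k x 0 n.2]
  simp [mul_comm]

end Pieri

/-! ### The moment at finite `N` -/

section FiniteN

variable {N : ℕ}

lemma charPolyZ_eq_prod (U : UnitaryN N) (θ : ℂ) :
    charPolyZ U θ = ∏ l, (1 - Complex.exp (-Complex.I * θ) * eigenvalue U l) := by
  have h := det_aeval_eq_prod U
    (1 - Polynomial.C (Complex.exp (-Complex.I * θ)) * Polynomial.X)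
  simp only [map_sub, map_one, map_mul, Polynomial.aeval_C, Polynomial.aeval_X,
    Polynomial.eval_sub, Polynomial.eval_one, Polynomial.eval_mul, Polynomial.eval_C,
    Polynomial.eval_X, Algebra.algebraMap_eq_smul_one, smul_mul_assoc, one_mul] at h
  exact h

lemma exp_neg_I_mul_arg_eigenvalue (U : UnitaryN N) (n : Fin N) :
    Complex.exp (-Complex.I * (Complex.arg (eigenvalue U n) : ℂ)) = (eigenvalue U n)⁻¹ := by
  have h := Complex.norm_mul_exp_arg_mul_I (eigenvalue U n)
  rw [norm_eigenvalue, Complex.ofReal_one, one_mul] at h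
  rw [neg_mul, Complex.exp_neg, mul_comm, h]

lemma shiftedProductMean_eq {k : ℕ} (α : Fin k → ℂ) (U : UnitaryN N) :
    shiftedProductMean α U = (1 / (N : ℂ)) *
      (star (U : Matrix (Fin N) (Fin N) ℂ).det ^ (N * k) * MvPolynomial.eval (eigenvalue U)
        (momentPoly N k fun r => Complex.exp (-Complex.I * α r))) := by
  have hne : ∀ n, eigenvalue U n ≠ 0 := fun n h => by
    have := norm_eigenvalue U n
    simp [h] at this
  have hstar : ∀ n, star (U : Matrix (Fin N) (Fin N) ℂ).det *
      ∏ l ∈ Finset.univ.erase n, eigenvalue U l = (eigenvalue U n)⁻¹ := by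
    intro n
    have h1 : star (U : Matrix (Fin N) (Fin N) ℂ).det * ∏ l, eigenvalue U l = 1 := by
      rw [← det_eq_prod_eigenvalue, ← Matrix.det_conjTranspose, ← Matrix.det_mul,
        ← Matrix.star_eq_conjTranspose, Matrix.mem_unitaryGroup_iff'.mp U.2, Matrix.det_one]
    rw [← Finset.mul_prod_erase _ _ (Finset.mem_univ n)] at h1
    apply eq_inv_of_mul_eq_one_left
    linear_combination h1
  rw [shiftedProductMean, eigenangles, roots_charpoly_eq_eigenvalue, Multiset.map_map,
    Multiset.map_map]
  congr 1
  change ∑ n, _ = _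
  simp only [Function.comp, momentPoly, map_sum, map_mul, map_pow, map_prod, map_sub,
    MvPolynomial.eval_X, MvPolynomial.eval_C]
  rw [Finset.mul_sum]
  refine Finset.sum_congr rfl fun n _ => ?_
  rw [← mul_assoc, ← mul_pow, hstar, pow_mul]
  have hk : ((eigenvalue U n)⁻¹ ^ N) ^ k = ∏ _r : Fin k, (eigenvalue U n)⁻¹ ^ N := by simp
  rw [hk, ← Finset.prod_mul_distrib]
  refine Finset.prod_congr rfl fun r _ => ?_
  have hN : (eigenvalue U n)⁻¹ ^ N = ∏ _l : Fin N, (eigenvalue U n)⁻¹ := by simp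
  rw [charPolyZ_eq_prod, mul_add, Complex.exp_add, exp_neg_I_mul_arg_eigenvalue, hN,
    ← Finset.prod_mul_distrib]
  refine Finset.prod_congr rfl fun l _ => ?_
  rw [mul_sub, inv_mul_cancel₀ (hne n)]
  ring

lemma integrable_shiftedProductMean (N : ℕ) {k : ℕ} (α : Fin k → ℂ) :
    Integrable (fun U : UnitaryN N => shiftedProductMean α U) (haarUnitary N) := by
  simp_rw [shiftedProductMean_eq]
  exact (integrable_haarMean _ (isSymmetric_momentPoly k _)).const_mul _

/-- The moment for finite `N`, in closed form. -/
theorem shiftedMoment_eq (N : ℕ) {k : ℕ} (α : Fin k → ℂ) :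
    shiftedMoment N α = (1 / (N : ℂ)) * ((∏ r, (1 - Complex.exp (-Complex.I * α r))) *
      ∑ d ∈ Finset.range N, truncGeom k (fun r => Complex.exp (-Complex.I * α r)) d) := by
  rw [← haarMean_momentPoly, shiftedMoment, haarMean, ← integral_const_mul]
  simp_rw [shiftedProductMean_eq]

end FiniteN

/-! ### Complete homogeneous polynomials -/

lemma completeHomog_zero {k : ℕ} (a : Fin k → ℂ) : completeHomog 0 a = 1 := by
  simp [completeHomog]

lemma completeHomog_eq_sum {k : ℕ} (m : ℕ) (a : Fin k → ℂ) :
    completeHomog m a = ∑ s : Sym (Fin k) m, ((s : Multiset (Fin k)).map a).prod := by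
  rw [completeHomog, MvPolynomial.hsymm, map_sum]
  refine Finset.sum_congr rfl fun s _ => ?_
  rw [map_multiset_prod, Multiset.map_map]
  simp [Function.comp_def]

lemma completeHomog_fin_zero (m : ℕ) (a : Fin 0 → ℂ) : completeHomog (m + 1) a = 0 := by
  rw [completeHomog_eq_sum]
  exact Finset.sum_eq_zero fun s _ => (s.exists_mem.choose).elim0

/-- Splitting the monomials according to whether the last variable occurs. -/
lemma completeHomog_succ {k : ℕ} (m : ℕ) (a : Fin (k + 1) → ℂ) :
    completeHomog (m + 1) a = completeHomog (m + 1) (fun r => a r.castSucc) +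
      a (Fin.last k) * completeHomog m a := by
  set b : Option (Fin k) → ℂ := fun o => a ((finSuccEquivLast (n := k)).symm o) with hb
  have hre : ∀ m, completeHomog m a =
      ∑ s : Sym (Option (Fin k)) m, ((s : Multiset (Option (Fin k))).map b).prod := by
    intro m
    rw [completeHomog_eq_sum]
    refine (Fintype.sum_equiv (Sym.equivCongr (finSuccEquivLast (n := k)).symm) _ _ ?_).symm
    intro s
    simp [hb, Multiset.map_map]
  rw [hre (m + 1), hre m, completeHomog_eq_sum,
    ← Equiv.sum_comp (symOptionSuccEquiv (α := Fin k) (n := m)).symm, Fintype.sum_sum_type, add_comm]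
  congr 1
  · refine Finset.sum_congr rfl fun s _ => ?_
    change (((SymOptionSuccEquiv.decode (Sum.inr s) : Sym (Option (Fin k)) (m + 1)) :
      Multiset (Option (Fin k))).map b).prod = _
    simp [hb, Multiset.map_map]
  · rw [Finset.mul_sum]
    refine Finset.sum_congr rfl fun s _ => ?_
    change (((SymOptionSuccEquiv.decode (Sum.inl s) : Sym (Option (Fin k)) (m + 1)) :
      Multiset (Option (Fin k))).map b).prod = _
    rw [SymOptionSuccEquiv.decode_inl, Sym.coe_cons, Multiset.map_cons, Multiset.prod_cons]
    simp [hb]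

section Limit

open Finset Filter Topology

lemma completeHomog_smul {k : ℕ} (m : ℕ) (c : ℂ) (a : Fin k → ℂ) :
    completeHomog m (fun r => c * a r) = c ^ m * completeHomog m a := by
  rw [completeHomog_eq_sum, completeHomog_eq_sum, mul_sum]
  refine sum_congr rfl fun s _ => ?_
  rw [Multiset.prod_map_mul, Multiset.map_const', Multiset.prod_replicate]
  congr 2
  exact s.2

lemma continuous_completeHomog {k : ℕ} (m : ℕ) :
    Continuous fun a : Fin k → ℂ => completeHomog m a :=
  MvPolynomial.continuous_eval _

lemma norm_completeHomog_le {k : ℕ} {W : ℝ} (hW : 0 ≤ W) (m : ℕ) {a : Fin k → ℂ}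
    (ha : ∀ r, ‖a r‖ ≤ W) : ‖completeHomog m a‖ ≤ (k * W) ^ m := by
  induction k generalizing m with
  | zero =>
    cases m with
    | zero => simp [completeHomog_zero]
    | succ m => simp [completeHomog_fin_zero]
  | succ k ih =>
    induction m with
    | zero => simp [completeHomog_zero]
    | succ m ihm =>
      rw [completeHomog_succ]
      have h1 := ih (m + 1) (a := fun r => a r.castSucc) fun r => ha _
      have hle : (k * W) ^ m ≤ ((k + 1 : ℕ) * W) ^ m := by
        gcongr
        simp
      calc _ ≤ (k * W) ^ (m + 1) + W * ((k + 1 : ℕ) * W) ^ m := by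
            refine (norm_add_le _ _).trans (add_le_add h1 ?_)
            rw [norm_mul]
            gcongr
            exact ha _
        _ ≤ (k * W) * ((k + 1 : ℕ) * W) ^ m + W * ((k + 1 : ℕ) * W) ^ m := by
            rw [pow_succ']
            gcongr
        _ = ((k + 1 : ℕ) * W) ^ (m + 1) := by
            push_cast
            ring

/-! ### The limit of the moments -/

lemma sum_truncGeom_succ (k : ℕ) (x : Fin (k + 1) → ℂ) (N : ℕ) :
    ∑ d ∈ range (N + 1), truncGeom (k + 1) x d =
      ∑ d ∈ range (N + 1), truncGeom k (fun r => x r.castSucc) d +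
        x (Fin.last k) * ∑ d ∈ range N, truncGeom (k + 1) x d := by
  have h0 : truncGeom (k + 1) x 0 = truncGeom k (fun r => x r.castSucc) 0 := by
    simp [truncGeom]
  have hs (d : ℕ) : truncGeom (k + 1) x (d + 1) =
      truncGeom k (fun r => x r.castSucc) (d + 1) + x (Fin.last k) * truncGeom (k + 1) x d := by
    rw [truncGeom, sum_range_succ', truncGeom, mul_sum, add_comm]
    congr 1
    · simp
    · refine sum_congr rfl fun i _ => ?_
      rw [Nat.add_sub_add_right, pow_succ]
      ring
  rw [sum_range_succ', sum_range_succ' (fun d => truncGeom k _ d), h0]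
  simp only [hs, sum_add_distrib, mul_sum]
  ring

/-- Expanding in powers of `y = x - 1` turns the partial sums of the complete homogeneous
polynomials into binomial coefficients; this is what makes the scaling `y = O(1/N)` transparent. -/
lemma sum_truncGeom_one_add (k : ℕ) (y : Fin k → ℂ) (N : ℕ) :
    ∑ d ∈ range N, truncGeom k (fun r => 1 + y r) d =
      ∑ m ∈ range N, completeHomog m y * ((N + k).choose (m + k + 1) : ℂ) := by
  induction k generalizing N with
  | zero =>
    cases N with
    | zero => simp
    | succ N =>
      rw [sum_range_succ' (fun m => completeHomog m y * _)]
      simp [completeHomog_fin_zero, completeHomog_zero, truncGeom]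
  | succ k ih =>
    induction N with
    | zero => simp
    | succ N ihN =>
      rw [sum_truncGeom_succ, ihN, ih]
      have hp (m : ℕ) : ((N + 1 + (k + 1)).choose (m + (k + 1) + 1) : ℂ) =
          ((N + 1 + k).choose (m + k + 1) : ℂ) + ((N + (k + 1)).choose (m + (k + 1) + 1) : ℂ) := by
        rw [show N + 1 + (k + 1) = (N + 1 + k) + 1 by ring,
          show m + (k + 1) + 1 = (m + k + 1) + 1 by ring, Nat.choose_succ_succ,
          show N + (k + 1) = N + 1 + k by ring]
        push_cast
        rfl
      have htop : ((N + (k + 1)).choose (N + (k + 1) + 1) : ℂ) = 0 := by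
        rw [Nat.choose_succ_self, Nat.cast_zero]
      simp only [hp, mul_add, sum_add_distrib]
      rw [sum_range_succ (fun m => completeHomog m y * ((N + (k + 1)).choose (m + (k + 1) + 1) : ℂ)),
        htop, sum_range_succ' (fun m => completeHomog m y * ((N + 1 + k).choose (m + k + 1) : ℂ)),
        sum_range_succ' (fun m => completeHomog m (fun r => y r.castSucc) * _)]
      simp only [completeHomog_succ, completeHomog_zero, add_mul, sum_add_distrib, mul_sum]
      have hsh (m : ℕ) : ((N + 1 + k).choose (m + 1 + k + 1) : ℂ) =
          ((N + (k + 1)).choose (m + (k + 1) + 1) : ℂ) := by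
        rw [show N + 1 + k = N + (k + 1) by ring, show m + 1 + k + 1 = m + (k + 1) + 1 by ring]
      simp only [hsh, one_mul, mul_assoc]
      ring

/-- The finite-`N` counterpart of `1 / (m + k + 1)!`, to which it converges. -/
noncomputable def chooseRatio (k N m : ℕ) : ℂ :=
  ((N + k).choose (m + k + 1) : ℂ) / (N : ℂ) ^ (m + k + 1)

lemma tendsto_chooseRatio (k m : ℕ) :
    Tendsto (fun N => chooseRatio k N m) atTop (𝓝 (1 / ((m + k + 1).factorial : ℂ))) := by
  have h1 : Tendsto (fun N : ℕ => ((N + k : ℕ) : ℝ) / (N : ℝ)) atTop (𝓝 1) := by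
    have : Tendsto (fun N : ℕ => 1 + (k : ℝ) / (N : ℝ)) atTop (𝓝 (1 + 0)) :=
      tendsto_const_nhds.add (tendsto_const_div_atTop_nhds_zero_nat _)
    rw [add_zero] at this
    refine this.congr' ?_
    filter_upwards [eventually_ge_atTop 1] with N hN
    have : (N : ℝ) ≠ 0 := by positivity
    push_cast
    field_simp
  have h2 : Tendsto (fun n : ℕ => (n : ℝ) * (1 / (n : ℝ))) atTop (𝓝 1) := by
    refine tendsto_const_nhds.congr' ?_
    filter_upwards [eventually_ge_atTop 1] with N hN
    have : (N : ℝ) ≠ 0 := by positivity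
    field_simp
  have h3 := (ProbabilityTheory.tendsto_choose_mul_pow_atTop (m + k + 1) h2).comp
    (tendsto_add_atTop_nat k)
  have h4 := h3.mul (h1.pow (m + k + 1))
  rw [one_pow, mul_one] at h4
  have h5 := (Complex.continuous_ofReal.tendsto _).comp h4
  push_cast at h5
  refine h5.congr' ?_
  filter_upwards [eventually_ge_atTop 1] with N hN
  have hN0 : (N : ℂ) ≠ 0 := by
    exact_mod_cast (by omega : N ≠ 0)
  have hNk : (N : ℂ) + k ≠ 0 := by
    exact_mod_cast (by omega : N + k ≠ 0)
  simp only [Function.comp, chooseRatio]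
  push_cast
  rw [mul_assoc, ← mul_pow, div_eq_mul_one_div (Nat.cast _), ← one_div_pow]
  congr 2
  field_simp

lemma norm_chooseRatio_le (k m : ℕ) {N : ℕ} (hN : N ≠ 0) :
    ‖chooseRatio k N m‖ ≤ (k + 1 : ℝ) ^ (m + k + 1) / (m + k + 1).factorial := by
  have hN1 : (1 : ℝ) ≤ N := by exact_mod_cast Nat.one_le_iff_ne_zero.mpr hN
  have h := Nat.choose_le_pow_div (α := ℝ) (m + k + 1) (N + k)
  rw [chooseRatio, norm_div, norm_pow, Complex.norm_natCast, Complex.norm_natCast,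
    div_le_iff₀ (by positivity), div_mul_eq_mul_div, ← mul_pow]
  refine h.trans ?_
  gcongr
  push_cast
  nlinarith [(Nat.cast_nonneg k : (0 : ℝ) ≤ k)]

/-- The common shape of the finite-`N` moment and of its limit: with `c = chooseRatio k N` and
`w r = N (e^{-i a_r / N} - 1)` it is the moment, with `c m = 1 / (m + k + 1)!` and `w r = -i a_r`
the limiting series. -/
noncomputable def scaledMoment {k : ℕ} (c : ℕ → ℂ) (w : Fin k → ℂ) : ℂ :=
  (∏ r, -w r) * ∑' m, completeHomog m w * c m

lemma shiftedMoment_eq_scaledMoment {k N : ℕ} (hN : N ≠ 0) (α : Fin k → ℂ) :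
    shiftedMoment N α =
      scaledMoment (chooseRatio k N) fun r => (N : ℂ) * (Complex.exp (-Complex.I * α r) - 1) := by
  have hN0 : (N : ℂ) ≠ 0 := Nat.cast_ne_zero.mpr hN
  obtain ⟨y, hy⟩ : ∃ y : Fin k → ℂ, y = fun r => Complex.exp (-Complex.I * α r) - 1 := ⟨_, rfl⟩
  have hx : (fun r => Complex.exp (-Complex.I * α r)) = fun r => 1 + y r := by
    funext r
    simp [hy]
  have hprod : ∏ r, (1 - Complex.exp (-Complex.I * α r)) = ∏ r, -y r := by
    refine prod_congr rfl fun r _ => ?_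
    simp [hy]
  have hw : (fun r => (N : ℂ) * (Complex.exp (-Complex.I * α r) - 1)) = fun r => N * y r := by
    rw [hy]
  rw [shiftedMoment_eq, hx, hprod, sum_truncGeom_one_add, hw, scaledMoment,
    tsum_eq_sum (s := range N)]
  · rw [mul_sum, mul_sum, mul_sum]
    refine sum_congr rfl fun m _ => ?_
    have : ∏ r, -((N : ℂ) * y r) = (N : ℂ) ^ k * ∏ r, -y r := by
      simp only [← mul_neg, prod_mul_distrib, prod_const, card_univ, Fintype.card_fin]
    rw [this, completeHomog_smul, chooseRatio]
    field_simp
    ring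
  · intro m hm
    rw [mem_range, not_lt] at hm
    rw [chooseRatio, Nat.choose_eq_zero_of_lt (by omega)]
    simp

lemma summable_scaled_bound (k : ℕ) (W : ℝ) :
    Summable fun m : ℕ => (k * W) ^ m * ((k + 1 : ℝ) ^ (m + k + 1) / (m + k + 1).factorial) := by
  have h := (Real.summable_pow_div_factorial ((k + 1) * (k * W))).mul_left ((k + 1 : ℝ) ^ (k + 1))
  refine Summable.of_norm_bounded h.norm fun m => ?_
  rw [Real.norm_eq_abs, Real.norm_eq_abs, abs_mul, abs_mul, abs_div, abs_div]
  simp only [Nat.abs_cast, abs_pow, abs_mul]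
  have hcomm (a b c d e : ℝ) : a * (b * c * d / e) = c * d * (b * a / e) := by ring
  rw [mul_pow, pow_add, pow_add, pow_add, hcomm]
  gcongr
  · rw [mul_pow, mul_pow]
  · omega

/-- Dominated convergence for `scaledMoment`, jointly in the coefficients and the variables. -/
lemma tendsto_scaledMoment {k : ℕ} {β : Type*} {l : Filter β} {c : β → ℕ → ℂ} {c₀ : ℕ → ℂ}
    {w : β → Fin k → ℂ} {w₀ : Fin k → ℂ} {W : ℝ} (hW : 0 ≤ W)
    (hw : Tendsto w l (𝓝 w₀)) (hwW : ∀ᶠ b in l, ∀ r, ‖w b r‖ ≤ W)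
    (hc : ∀ m, Tendsto (fun b => c b m) l (𝓝 (c₀ m)))
    (hcb : ∀ᶠ b in l, ∀ m, ‖c b m‖ ≤ (k + 1 : ℝ) ^ (m + k + 1) / (m + k + 1).factorial) :
    Tendsto (fun b => scaledMoment (c b) (w b)) l (𝓝 (scaledMoment c₀ w₀)) := by
  refine Tendsto.mul ?_ ?_
  · exact tendsto_finsetProd _ fun r _ => ((tendsto_pi_nhds.mp hw) r).neg
  · refine tendsto_tsum_of_dominated_convergence (summable_scaled_bound k W) (fun m => ?_) ?_
    · exact (((continuous_completeHomog m).tendsto w₀).comp hw).mul (hc m)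
    · filter_upwards [hwW, hcb] with b hb hb' m
      rw [norm_mul]
      exact mul_le_mul (norm_completeHomog_le hW m hb) (hb' m) (norm_nonneg _) (by positivity)

lemma limitTerm_eq {k : ℕ} (a : Fin k → ℂ) (m : ℕ) :
    limitTerm a m = (∏ r, -(-Complex.I * a r)) *
      (completeHomog m (fun r => -Complex.I * a r) * (1 / ((m + k + 1).factorial : ℂ))) := by
  rw [completeHomog_smul, limitTerm]
  simp only [neg_mul, neg_neg, prod_mul_distrib, prod_const, card_univ, Fintype.card_fin]
  rw [neg_pow Complex.I]
  ring

lemma norm_one_div_factorial_le (k m : ℕ) :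
    ‖1 / ((m + k + 1).factorial : ℂ)‖ ≤ (k + 1 : ℝ) ^ (m + k + 1) / (m + k + 1).factorial := by
  rw [norm_div, norm_one, Complex.norm_natCast]
  gcongr
  exact one_le_pow₀ (by linarith [(Nat.cast_nonneg k : (0 : ℝ) ≤ k)])

lemma summable_limitTerm {k : ℕ} (a : Fin k → ℂ) : Summable (limitTerm a) := by
  rw [funext (limitTerm_eq a)]
  refine Summable.mul_left _ (Summable.of_norm_bounded (summable_scaled_bound k ‖a‖) fun m => ?_)
  rw [norm_mul]
  refine mul_le_mul (norm_completeHomog_le (norm_nonneg a) m fun r => ?_)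
    (norm_one_div_factorial_le k m) (norm_nonneg _) (by positivity)
  simpa using norm_le_pi_norm a r

lemma tsum_limitTerm {k : ℕ} (a : Fin k → ℂ) :
    ∑' m, limitTerm a m = scaledMoment (fun m => 1 / ((m + k + 1).factorial : ℂ))
      fun r => -Complex.I * a r := by
  simp only [limitTerm_eq]
  rw [tsum_mul_left, scaledMoment]

lemma norm_natCast_mul_exp_sub_one_le {N : ℕ} {R : ℝ} (hN : N ≠ 0) (hR : R ≤ N) {z : ℂ}
    (hz : ‖z‖ ≤ R) :
    ‖(N : ℂ) * (Complex.exp (z / N) - 1)‖ ≤ 2 * R ∧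
      ‖(N : ℂ) * (Complex.exp (z / N) - 1) - z‖ ≤ R ^ 2 / N := by
  have hN0 : (N : ℂ) ≠ 0 := Nat.cast_ne_zero.mpr hN
  have hNpos : (0 : ℝ) < N := by positivity
  have hn : ‖z / N‖ = ‖z‖ / N := by rw [norm_div, Complex.norm_natCast]
  have h1 : ‖z / N‖ ≤ 1 := by
    rw [hn, div_le_one hNpos]
    exact hz.trans hR
  constructor
  · have := Complex.norm_exp_sub_one_le h1
    rw [norm_mul, Complex.norm_natCast]
    calc _ ≤ (N : ℝ) * (2 * ‖z / N‖) := by gcongr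
      _ = 2 * ‖z‖ := by rw [hn]; field_simp
      _ ≤ _ := by gcongr
  · have := Complex.norm_exp_sub_one_sub_id_le h1
    have he : (N : ℂ) * (Complex.exp (z / N) - 1) - z =
        N * (Complex.exp (z / N) - 1 - z / N) := by
      field_simp
    rw [he, norm_mul, Complex.norm_natCast]
    calc _ ≤ (N : ℝ) * ‖z / N‖ ^ 2 := by gcongr
      _ = ‖z‖ ^ 2 / N := by rw [hn]; field_simp
      _ ≤ _ := by gcongr

lemma isCompact_forall_norm_le (k : ℕ) (R : ℝ) :
    IsCompact {a : Fin k → ℂ | ∀ r, ‖a r‖ ≤ R} := by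
  have : {a : Fin k → ℂ | ∀ r, ‖a r‖ ≤ R} =
      Set.univ.pi fun _ : Fin k => Metric.closedBall (0 : ℂ) R := by
    ext a
    simp
  rw [this]
  exact isCompact_univ_pi fun _ => isCompact_closedBall 0 R

lemma tendsto_scaled_variables {k : ℕ} {R : ℝ} (a₀ : Fin k → ℂ) :
    Tendsto (fun p : ℕ × (Fin k → ℂ) => fun r =>
        (p.1 : ℂ) * (Complex.exp (-Complex.I * p.2 r / p.1) - 1))
      (atTop ×ˢ 𝓝[{a | ∀ r, ‖a r‖ ≤ R}] a₀) (𝓝 fun r => -Complex.I * a₀ r) := by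
  refine tendsto_pi_nhds.mpr fun r => ?_
  have hlim : Tendsto (fun p : ℕ × (Fin k → ℂ) => -Complex.I * p.2 r)
      (atTop ×ˢ 𝓝[{a | ∀ r, ‖a r‖ ≤ R}] a₀) (𝓝 (-Complex.I * a₀ r)) := by
    have : Continuous fun a : Fin k → ℂ => -Complex.I * a r := by fun_prop
    exact ((this.tendsto a₀).mono_left nhdsWithin_le_nhds).comp tendsto_snd
  have herr : Tendsto (fun p : ℕ × (Fin k → ℂ) =>
      (p.1 : ℂ) * (Complex.exp (-Complex.I * p.2 r / p.1) - 1) - -Complex.I * p.2 r)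
      (atTop ×ˢ 𝓝[{a | ∀ r, ‖a r‖ ≤ R}] a₀) (𝓝 0) := by
    refine squeeze_zero_norm' (a := fun p => R ^ 2 / (p.1 : ℝ)) ?_
      ((tendsto_const_div_atTop_nhds_zero_nat (R ^ 2)).comp tendsto_fst)
    filter_upwards [tendsto_fst.eventually (eventually_ne_atTop 0),
      tendsto_fst.eventually (eventually_ge_atTop ⌈R⌉₊),
      tendsto_snd.eventually eventually_mem_nhdsWithin] with p hp hpR hpa
    exact (norm_natCast_mul_exp_sub_one_le hp (Nat.ceil_le.mp hpR) (by simpa using hpa r)).2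
  simpa using herr.add hlim

end Limit

open Filter Topology in
theorem theorem3 (k : ℕ) :
    (∀ (N : ℕ) (α : Fin k → ℂ),
      MeasureTheory.Integrable (fun U : UnitaryN N => shiftedProductMean α U) (haarUnitary N)) ∧
    (∀ a : Fin k → ℂ, Summable (fun m : ℕ => limitTerm a m)) ∧
    (∀ R : ℝ, TendstoUniformlyOn
      (fun (N : ℕ) (a : Fin k → ℂ) => shiftedMoment N (fun r => a r / (N : ℂ)))
      (fun a : Fin k → ℂ => ∑' m : ℕ, limitTerm a m)
      Filter.atTop
      {a : Fin k → ℂ | ∀ r, ‖a r‖ ≤ R}) := by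
  refine ⟨fun N α => integrable_shiftedProductMean N α, summable_limitTerm, fun R => ?_⟩
  rw [← tendstoLocallyUniformlyOn_iff_tendstoUniformlyOn_of_compact (isCompact_forall_norm_le k R),
    tendstoLocallyUniformlyOn_iff_forall_tendsto]
  intro a₀ ha₀
  refine Tendsto.mono_right ?_ (nhds_le_uniformity (∑' m, limitTerm a₀ m))
  rw [nhds_prod_eq]
  have hmem : ∀ᶠ p : ℕ × (Fin k → ℂ) in atTop ×ˢ 𝓝[{a | ∀ r, ‖a r‖ ≤ R}] a₀,
      ∀ r, ‖p.2 r‖ ≤ R := tendsto_snd.eventually eventually_mem_nhdsWithin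
  have hne : ∀ᶠ p : ℕ × (Fin k → ℂ) in atTop ×ˢ 𝓝[{a | ∀ r, ‖a r‖ ≤ R}] a₀, p.1 ≠ 0 :=
    tendsto_fst.eventually (eventually_ne_atTop 0)
  refine Tendsto.prodMk ?_ ?_
  · simp only [tsum_limitTerm]
    refine tendsto_scaledMoment (abs_nonneg R) ?_ ?_ (fun m => tendsto_const_nhds)
      (.of_forall fun _ => norm_one_div_factorial_le k)
    · have : Continuous fun a : Fin k → ℂ => fun r => -Complex.I * a r := by fun_prop
      exact ((this.tendsto a₀).mono_left nhdsWithin_le_nhds).comp tendsto_snd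
    · filter_upwards [hmem] with p hp r
      simpa using (hp r).trans (le_abs_self R)
  · rw [tsum_limitTerm]
    have hscaled := tendsto_scaledMoment (k := k) (c := fun p : ℕ × (Fin k → ℂ) => chooseRatio k p.1)
      (W := |2 * R|) (abs_nonneg _) (tendsto_scaled_variables (R := R) a₀) ?_
      (fun m => (tendsto_chooseRatio k m).comp tendsto_fst)
      (hne.mono fun p hp m => norm_chooseRatio_le k m hp)
    · refine hscaled.congr' ?_
      filter_upwards [hne] with p hp
      rw [shiftedMoment_eq_scaledMoment hp]
      simp only [mul_div_assoc]
    · filter_upwards [hmem, hne,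
        tendsto_fst.eventually (eventually_ge_atTop ⌈R⌉₊)] with p hp hp0 hpR r
      exact (norm_natCast_mul_exp_sub_one_le hp0 (Nat.ceil_le.mp hpR)
        (by simpa using hp r)).1.trans (le_abs_self _)
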